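/- Let $G$ be a real semisimple Lie group with Lie algebra $\mathfrak g$ and Killing form $B$, let $P\subset G$ be a parabolic subgroup with Lie algebra $\mathfrak p$, and let $\mathfrak p_+\subset\mathfrak p$ be the annihilator of $\mathfrak p$ with respect to $B$, so that $(\mathfrak g/\mathfrak p)^*\cong\mathfrak p_+$. Let $V$ be a finite-dimensional real or complex irreducible representation of $\mathfrak g$ with a compatible smooth action of $P$, i.e. an action that has the restriction of the $\mathfrak g$-action to $\mathfrak p$ as its derivative and satisfies $h\cdot(X\cdot v)=\operatorname{Ad}(h)X\cdot(h\cdot v)$ for $h\in P$, $X\in\mathfrak g$, $v\in V$ (for example the restriction of a representation of $G$). Let $c_0$ be the eigenvalue on $V$ of the Casimir operator $v\mapsto\sum_\ell\xi^\ell\cdot\xi_\ell\cdot v$, where $\{\xi^\ell\}$, $\{\xi_\ell\}$ are bases of $\mathfrak g$ that are dual with respect to $B$. Let $(\mathcal G\to M,\omega)$ be a Cartan geometry of type $(G,P)$ with tractor bundle $VM=\mathcal G\times_PV$, whose $k$-forms $\Omega^k(M,VM)$ are identified with the smooth $P$-equivariant functions $\mathcal G\to\Lambda^k\mathfrak p_+\otimes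 V$. * The fundamental derivative of a $P$-equivariant function $f:\mathcal G\to W$ with values in a representation $W$ of $P$ is the $P$-equivariant function $Df:\mathcal G\to\mathfrak g^*\otimes W$, $(Df)(u)(X)=(\omega_u^{-1}(X)\cdot f)(u)$, and the curved Casimir operator is $\mathcal C f=\sum_\ell(D^2f)(\xi^\ell,\xi_\ell)$. * The tractor connection $\nabla$ on $VM$ is induced by $X\mapsto D_Xf+X\cdot f$, and $d^{\nabla}:\Omega^k(M,VM)\to\Omega^{k+1}(M,VM)$ is its covariant exterior derivative. * The codifferential $\partial^*:\Omega^k(M,VM)\to\Omega^{k-1}(M,VM)$ is the bundle map induced by $$\partial^*(Z_1\wedge\dots\wedge Z_k\otimes v)=\sum_{i}(-1)^iZ_1\wedge\dots\widehat{Z_i}\dots\wedge Z_k\otimes Z_i\cdot v+\sum_{i<j}(-1)^{i+j}[Z_i,Z_j]\wedge Z_1\wedge\dots\widehat{Z_i}\dots\widehat{Z_j}\dots\wedge Z_k\otimes v,$$ with $\partial^*=0$ for $k=0$, and $\square^R=\partial^*\circ d^{\nabla}+d^{\nabla}\circ\partial^*$. Then on the homogeneous model $G\to G/P$ with the Maurer–Cartan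 form, and on every geometry of type $(G,P)$ that is locally isomorphic to it (locally flat geometries), one has $\mathcal C=2\,\square^R+c_0$ on $\Omega^k(M,VM)$ for all $k\ge0$. -/

import Mathlib

open scoped Manifold ContDiff

namespace CurvedCasimir

set_option linter.unusedSectionVars false

noncomputable section

/-! ### The Lie algebra of a Lie group as a normed space, and the adjoint action -/

section LieGroups

variable {E : Type*} [NormedAddCommGroup E] [NormedSpace ℝ E]
  {G : Type*} [TopologicalSpace G] [ChartedSpace E G] [Group G]

/-- A smooth Lie group has the regularity under which Mathlib defines the Lie algebra. -/
instance instLieGroupMinSmoothness [LieGroup 𝓘(ℝ, E) ∞ G] :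
    LieGroup 𝓘(ℝ, E) (minSmoothness ℝ 3) G :=
  LieGroup.of_le (n := ∞) (by
    rw [minSmoothness_of_isRCLikeNormedField]; exact WithTop.coe_le_coe.2 le_top)

/-- The Lie algebra `𝔤 = T₁G` of a Lie group `G` modelled on the vector space `E`. -/
abbrev LieAlg (E : Type*) [NormedAddCommGroup E] [NormedSpace ℝ E]
    (G : Type*) [TopologicalSpace G] [ChartedSpace E G] [Group G] : Type _ :=
  GroupLieAlgebra 𝓘(ℝ, E) G

/-- `T₁G` carries the norm of the model space `E` (any norm would do, `E` being finite
dimensional in the sequel); its topology and vector space structure are the given ones. -/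
instance : MetricSpace (LieAlg E G) :=
  MetricSpace.replaceTopology (U := instTopologicalSpaceTangentSpace 𝓘(ℝ, E) (1 : G))
    (show MetricSpace E from inferInstance) rfl

instance : NormedAddCommGroup (LieAlg E G) where
  toAddCommGroup := instAddCommGroupTangentSpace 𝓘(ℝ, E) (1 : G)
  norm := fun X => norm (E := E) X
  dist_eq X Y := dist_eq_norm_neg_add (E := E) X Y

instance : NormedSpace ℝ (LieAlg E G) where
  toModule := instModuleTangentSpace 𝓘(ℝ, E) (1 : G)
  norm_smul_le c X := _root_.norm_smul_le (β := E) c X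

instance [FiniteDimensional ℝ E] : FiniteDimensional ℝ (LieAlg E G) :=
  inferInstanceAs (FiniteDimensional ℝ E)

/-- The adjoint action `Ad(g)` on `𝔤`, the derivative at `1` of `x ↦ g x g⁻¹`. -/
def Ad (g : G) : LieAlg E G →L[ℝ] LieAlg E G :=
  (mfderiv 𝓘(ℝ, E) 𝓘(ℝ, E) (fun x : G => g * x * g⁻¹) 1 : E →L[ℝ] E)

end LieGroups

/-! ### Dual bases for the Killing form, and the Casimir operator of a representation -/

section Casimir

variable {𝔤 : Type*} [LieRing 𝔤] [LieAlgebra ℝ 𝔤] [FiniteDimensional ℝ 𝔤]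

/-- A basis `ξ_l` of `𝔤`. -/
def lowerBasis (𝔤 : Type*) [LieRing 𝔤] [LieAlgebra ℝ 𝔤] [FiniteDimensional ℝ 𝔤] :
    Module.Basis (Fin (Module.finrank ℝ 𝔤)) ℝ 𝔤 :=
  Module.finBasis ℝ 𝔤

/-- The basis `ξ^l` of `𝔤` with `B(ξ^i, ξ_j) = δ_{ij}` for the Killing form `B`. -/
def upperBasis (𝔤 : Type*) [LieRing 𝔤] [LieAlgebra ℝ 𝔤] [FiniteDimensional ℝ 𝔤]
    [LieAlgebra.IsKilling ℝ 𝔤] : Module.Basis (Fin (Module.finrank ℝ 𝔤)) ℝ 𝔤 :=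
  LinearMap.BilinForm.dualBasis (killingForm ℝ 𝔤)
    (LieAlgebra.IsKilling.killingForm_nondegenerate ℝ 𝔤) (lowerBasis 𝔤)

variable {𝕜 : Type*} [RCLike 𝕜] {V : Type*} [AddCommGroup V] [Module 𝕜 V] [Module ℝ V]
  [IsScalarTower ℝ 𝕜 V]

/-- The Casimir operator `v ↦ ∑ ξ^l · ξ_l · v` of a representation of `𝔤` on a real or complex
vector space `V`. -/
def casimir [LieAlgebra.IsKilling ℝ 𝔤] (ρ : 𝔤 →ₗ[ℝ] Module.End 𝕜 V) : Module.End 𝕜 V :=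
  ∑ l, ρ (upperBasis 𝔤 l) * ρ (lowerBasis 𝔤 l)

/-- Irreducibility of a representation of `𝔤`. -/
def IsIrreducible (ρ : 𝔤 →ₗ[ℝ] Module.End 𝕜 V) : Prop :=
  Nontrivial V ∧ ∀ U : Submodule 𝕜 V, (∀ X, ∀ v ∈ U, ρ X v ∈ U) → U = ⊥ ∨ U = ⊤

/-- The Kostant codifferential `∂* : Λ^{k+1} 𝔭₊ ⊗ V → Λ^k 𝔭₊ ⊗ V`, the Lie algebra homology
differential. Here `𝔭₊`, the annihilator of `𝔭` for the Killing form `B`, is identified with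
`(𝔤/𝔭)^*` by `B`, so that elements of `Λ^k 𝔭₊ ⊗ V` are the `V`-valued alternating maps in `k`
arguments from `𝔤` that vanish if an argument lies in `𝔭`. The defining formula on decomposable
elements is `codifferential_wedge` (and `codifferential_wedge_one`) below. -/
def codifferential [LieAlgebra.IsKilling ℝ 𝔤] (ρ : 𝔤 →ₗ[ℝ] Module.End 𝕜 V) {k : ℕ}
    (φ : (Fin (k + 1) → 𝔤) → V) (Y : Fin k → 𝔤) : V :=
  -(∑ l, ρ (upperBasis 𝔤 l) (φ (Fin.cons (lowerBasis 𝔤 l) Y)))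
    + (1 / 2 : ℝ) • ∑ l, ∑ j, φ (Fin.cons (lowerBasis 𝔤 l)
        (Function.update Y j ⁅upperBasis 𝔤 l, Y j⁆))

/-- The matrix `B(Z_i, Y_j)`. -/
def gram {k : ℕ} (Z Y : Fin k → 𝔤) : Matrix (Fin k) (Fin k) ℝ :=
  Matrix.of fun i j => killingForm ℝ 𝔤 (Z i) (Y j)

/-- The decomposable element `Z_1 ∧ ⋯ ∧ Z_k ⊗ v` as a `V`-valued alternating map on `𝔤`, each
`Z_i` being viewed as the linear form `B(Z_i, ·)`. -/
def wedge {k : ℕ} (Z : Fin k → 𝔤) (v : V) (Y : Fin k → 𝔤) : V :=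
  (gram Z Y).det • v

lemma sum_killingForm_smul [LieAlgebra.IsKilling ℝ 𝔤] (z : 𝔤) :
    ∑ l, killingForm ℝ 𝔤 z (lowerBasis 𝔤 l) • upperBasis 𝔤 l = z := by
  conv_rhs => rw [← (upperBasis 𝔤).sum_repr z]
  refine Finset.sum_congr rfl fun l _ => ?_
  rw [upperBasis, LinearMap.BilinForm.dualBasis_repr_apply]

lemma det_gram_cons {k : ℕ} (Z : Fin (k + 1) → 𝔤) (y : 𝔤) (Y : Fin k → 𝔤) :
    (gram Z (Fin.cons y Y)).det =
      ∑ i : Fin (k + 1), (-1) ^ (i : ℕ) * killingForm ℝ 𝔤 (Z i) y * (gram (i.removeNth Z) Y).det := by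
  rw [Matrix.det_succ_column_zero]
  rfl

lemma det_gram_insertNth {k : ℕ} (q : Fin (k + 1)) (x : 𝔤) (Z : Fin k → 𝔤) (Y : Fin (k + 1) → 𝔤) :
    (gram (q.insertNth x Z) Y).det = (-1) ^ (q : ℕ) * (gram (Fin.cons x Z) Y).det := by
  rw [Matrix.det_succ_row _ q, Matrix.det_succ_row _ 0, Finset.mul_sum]
  refine Finset.sum_congr rfl fun b _ => ?_
  have h1 : (gram (q.insertNth x Z) Y).submatrix q.succAbove b.succAbove
      = gram Z (b.removeNth Y) := by
    ext a c; simp [gram, Fin.removeNth]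
  have h2 : (gram (Fin.cons x Z) Y).submatrix (0 : Fin (k + 1)).succAbove b.succAbove
      = gram Z (b.removeNth Y) := by
    ext a c; simp [gram, Fin.removeNth]
  rw [h1, h2]
  simp [gram, pow_add]
  ring

lemma det_gram_update_right {k : ℕ} (Z Y : Fin k → 𝔤) (j : Fin k) (y : 𝔤) :
    (gram Z (Function.update Y j y)).det
      = ∑ a, (gram Z Y).adjugate j a * killingForm ℝ 𝔤 (Z a) y := by
  have : gram Z (Function.update Y j y)
      = (gram Z Y).updateCol j (fun a => killingForm ℝ 𝔤 (Z a) y) := by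
    ext a b
    by_cases h : b = j
    · subst h; simp [gram]
    · simp [gram, h]
  rw [this, ← Matrix.cramer_apply, Matrix.cramer_eq_adjugate_mulVec]
  rfl

lemma det_gram_update_left {k : ℕ} (Z Y : Fin k → 𝔤) (a : Fin k) (z : 𝔤) :
    (gram (Function.update Z a z) Y).det
      = ∑ j, (gram Z Y).adjugate j a * killingForm ℝ 𝔤 z (Y j) := by
  have : gram (Function.update Z a z) Y
      = (gram Z Y).updateRow a (fun j => killingForm ℝ 𝔤 z (Y j)) := by
    ext b j
    by_cases h : b = a
    · subst h; simp [gram]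
    · simp [gram, h]
  rw [this, ← Matrix.cramer_transpose_apply, Matrix.cramer_eq_adjugate_mulVec,
    ← Matrix.adjugate_transpose]
  rfl

lemma sum_det_gram_update {k : ℕ} (Z Y : Fin k → 𝔤) (z : 𝔤) :
    ∑ j, (gram Z (Function.update Y j ⁅z, Y j⁆)).det
      = ∑ q, (gram (Function.update Z q ⁅Z q, z⁆) Y).det := by
  simp_rw [det_gram_update_right, det_gram_update_left]
  rw [Finset.sum_comm]
  refine Finset.sum_congr rfl fun a _ => Finset.sum_congr rfl fun j _ => ?_
  rw [LieModule.traceForm_apply_lie_apply]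

lemma sum_det_gram_lie {m : ℕ} (Z : Fin (m + 2) → 𝔤) (Y : Fin (m + 1) → 𝔤) :
    ∑ i : Fin (m + 2), ∑ j, (-1) ^ (i : ℕ) *
        (gram (i.removeNth Z) (Function.update Y j ⁅Z i, Y j⁆)).det
      = 2 * ∑ i : Fin (m + 1), ∑ j ∈ Finset.Ici i, (-1) ^ (i.castSucc + j.succ : ℕ) *
        (gram (Fin.cons ⁅Z i.castSucc, Z j.succ⁆ (j.removeNth (i.castSucc.removeNth Z))) Y).det := by
  have hneg (x : 𝔤) (w : Fin m → 𝔤) :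
      (gram (Fin.cons (-x) w) Y).det = -(gram (Fin.cons x w) Y).det := by
    have h := det_gram_update_left (Fin.cons x w) Y 0 (-x)
    have h' := det_gram_update_left (Fin.cons x w) Y 0 x
    rw [Fin.update_cons_zero] at h h'
    rw [h, h', ← Finset.sum_neg_distrib]
    simp
  have hupd (w : Fin (m + 1) → 𝔤) (q : Fin (m + 1)) (x : 𝔤) :
      (gram (Function.update w q x) Y).det
        = (-1) ^ (q : ℕ) * (gram (Fin.cons x (q.removeNth w)) Y).det := by
    rw [← det_gram_insertNth, Fin.insertNth_removeNth]
  simp_rw [← Finset.mul_sum, sum_det_gram_update, Finset.mul_sum]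
  rw [Fin.sum_sum_eq_sum_triangle_add]
  refine Finset.sum_congr rfl fun i _ => Finset.sum_congr rfl fun j hj => ?_
  rw [Finset.mem_Ici] at hj
  have H₁ : i.castSucc.succAbove j = j.succ := by simp [Fin.succAbove_of_le_castSucc, hj]
  have H₃ : j.succ.succAbove i = i.castSucc := by simp [Fin.succAbove_of_castSucc_lt, hj]
  have H₂ : j.predAbove i.castSucc = i := by simp [Fin.predAbove_of_le_castSucc, hj]
  have H₄ : i.removeNth (j.succ.removeNth Z) = j.removeNth (i.castSucc.removeNth Z) := by
    rw [Fin.removeNth_removeNth_eq_swap _ j i.castSucc, H₁, H₂]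
  rw [hupd, hupd, H₄]
  simp only [Fin.removeNth, H₁, H₃]
  rw [← lie_skew, hneg]
  simp only [Fin.val_castSucc, Fin.val_succ, pow_add, pow_one]
  ring

lemma codifferential_wedge_aux [LieAlgebra.IsKilling ℝ 𝔤] (ρ : 𝔤 →ₗ[ℝ] Module.End 𝕜 V) {k : ℕ}
    (Z : Fin (k + 1) → 𝔤) (v : V) (Y : Fin k → 𝔤) :
    codifferential ρ (wedge Z v) Y =
      ∑ i : Fin (k + 1), (-1 : ℝ) ^ (i + 1 : ℕ) • wedge (i.removeNth Z) (ρ (Z i) v) Y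
      + (1 / 2 : ℝ) • (∑ i : Fin (k + 1), ∑ j, (-1) ^ (i : ℕ) *
        (gram (i.removeNth Z) (Function.update Y j ⁅Z i, Y j⁆)).det) • v := by
  unfold codifferential wedge
  congr 1
  · have h (i : Fin (k + 1)) : ρ (Z i) v
        = ∑ l, killingForm ℝ 𝔤 (Z i) (lowerBasis 𝔤 l) • ρ (upperBasis 𝔤 l) v := by
      conv_lhs => rw [← sum_killingForm_smul (Z i)]
      simp
    simp_rw [h, det_gram_cons, LinearMap.map_smul_of_tower, Finset.smul_sum, Finset.sum_smul]
    rw [Finset.sum_comm, ← Finset.sum_neg_distrib]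
    refine Finset.sum_congr rfl fun i _ => ?_
    rw [← Finset.sum_neg_distrib]
    refine Finset.sum_congr rfl fun l _ => ?_
    rw [smul_smul, smul_smul, ← neg_smul]
    congr 1
    ring
  · congr 1
    have h (i : Fin (k + 1)) (j : Fin k) :
        (gram (i.removeNth Z) (Function.update Y j ⁅Z i, Y j⁆)).det
        = ∑ l, killingForm ℝ 𝔤 (Z i) (lowerBasis 𝔤 l) *
          (gram (i.removeNth Z) (Function.update Y j ⁅upperBasis 𝔤 l, Y j⁆)).det := by
      conv_lhs => rw [← sum_killingForm_smul (Z i)]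
      simp_rw [det_gram_update_right, sum_lie, smul_lie, map_sum, map_smul,
        Finset.mul_sum, smul_eq_mul]
      rw [Finset.sum_comm]
      refine Finset.sum_congr rfl fun l _ => Finset.sum_congr rfl fun a _ => ?_
      simp [Fin.removeNth]
      ring
    simp_rw [det_gram_cons, h, ← Finset.sum_smul]
    congr 1
    simp_rw [Finset.mul_sum]
    rw [Finset.sum_comm_cycle]
    refine Finset.sum_congr rfl fun i _ => ?_
    rw [Finset.sum_comm]
    refine Finset.sum_congr rfl fun l _ => Finset.sum_congr rfl fun j _ => ?_
    ring

/-- The codifferential on decomposable elements: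
`∂*(Z_0 ∧ ⋯ ∧ Z_k ⊗ v) = ∑_i (-1)^{i+1} Z_0 ∧ ⋯ Ẑ_i ⋯ ∧ Z_k ⊗ Z_i·v
  + ∑_{i<j} (-1)^{i+j} [Z_i, Z_j] ∧ Z_0 ∧ ⋯ Ẑ_i ⋯ Ẑ_j ⋯ ∧ Z_k ⊗ v`
(indices start at `0`; the pairs `i < j` are the pairs `(i.castSucc, j.succ)` with `i ≤ j`). -/
theorem codifferential_wedge [LieAlgebra.IsKilling ℝ 𝔤] (ρ : 𝔤 →ₗ[ℝ] Module.End 𝕜 V) {m : ℕ}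
    (Z : Fin (m + 2) → 𝔤) (v : V) :
    codifferential ρ (wedge Z v) =
      ∑ i : Fin (m + 2), (-1 : ℝ) ^ (i + 1 : ℕ) • wedge (i.removeNth Z) (ρ (Z i) v)
      + ∑ i : Fin (m + 1), ∑ j ∈ Finset.Ici i, (-1 : ℝ) ^ (i.castSucc + j.succ : ℕ) •
        wedge (Fin.cons ⁅Z i.castSucc, Z j.succ⁆ (j.removeNth (i.castSucc.removeNth Z))) v := by
  funext Y
  rw [codifferential_wedge_aux, sum_det_gram_lie]
  simp only [Pi.add_apply, Finset.sum_apply, Pi.smul_apply]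
  congr 1
  rw [smul_smul, ← mul_assoc]
  norm_num [wedge, Finset.sum_smul, mul_smul]

/-- The codifferential on elements of degree one: `∂*(Z ⊗ v) = -Z·v`. -/
theorem codifferential_wedge_one [LieAlgebra.IsKilling ℝ 𝔤] (ρ : 𝔤 →ₗ[ℝ] Module.End 𝕜 V)
    (Z : Fin 1 → 𝔤) (v : V) (Y : Fin 0 → 𝔤) :
    codifferential ρ (wedge Z v) Y = -ρ (Z 0) v := by
  rw [codifferential_wedge_aux]
  simp [wedge]

end Casimir

/-! ### Parabolic subgroups -/

section Parabolic

/-- A subalgebra `𝔭` of a (semisimple) real Lie algebra `𝔤` is parabolic if there is a grading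
`𝔤 = 𝔤_{-k} ⊕ ⋯ ⊕ 𝔤_k` of the Lie algebra `𝔤` with `𝔭 = 𝔤₀ ⊕ ⋯ ⊕ 𝔤_k`. -/
def IsParabolic {𝔤 : Type*} [LieRing 𝔤] [LieAlgebra ℝ 𝔤] (𝔭 : Submodule ℝ 𝔤) : Prop :=
  ∃ gr : ℤ → Submodule ℝ 𝔤, DirectSum.IsInternal gr ∧
    (∀ i j, ∀ X ∈ gr i, ∀ Y ∈ gr j, ⁅X, Y⁆ ∈ gr (i + j)) ∧
    𝔭 = ⨆ i : {i : ℤ // 0 ≤ i}, gr i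

/-- A parabolic subgroup of the Lie group `G`: a closed Lie subgroup (a Lie group `P` with an
embedding `ι : P → G` as a closed subgroup) whose Lie algebra is parabolic. -/
structure ParabolicSubgroup
    (E : Type*) [NormedAddCommGroup E] [NormedSpace ℝ E] [FiniteDimensional ℝ E]
    (G : Type*) [TopologicalSpace G] [ChartedSpace E G] [Group G] [LieGroup 𝓘(ℝ, E) ∞ G]
    (EP : Type*) [NormedAddCommGroup EP] [NormedSpace ℝ EP]
    (P : Type*) [TopologicalSpace P] [ChartedSpace EP P] [Group P] [LieGroup 𝓘(ℝ, EP) ∞ P] where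
  /-- the inclusion -/
  ι : P →* G
  contMDiff_ι : ContMDiff 𝓘(ℝ, EP) 𝓘(ℝ, E) ∞ ι
  isClosedEmbedding_ι : Topology.IsClosedEmbedding ι
  /-- the derivative of the inclusion at `1`, as a map from the Lie algebra of `P` to `𝔤` -/
  dι : LieAlg EP P →L[ℝ] LieAlg E G
  dι_eq : dι = (mfderiv 𝓘(ℝ, EP) 𝓘(ℝ, E) ι 1 : EP →L[ℝ] E)
  injective_dι : Function.Injective dι
  isParabolic : IsParabolic (LinearMap.range (dι : LieAlg EP P →ₗ[ℝ] LieAlg E G))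

end Parabolic

section Geometry

variable {E : Type*} [NormedAddCommGroup E] [NormedSpace ℝ E] [FiniteDimensional ℝ E]
  {G : Type*} [TopologicalSpace G] [ChartedSpace E G] [Group G] [LieGroup 𝓘(ℝ, E) ∞ G]
  {EP : Type*} [NormedAddCommGroup EP] [NormedSpace ℝ EP]
  {P : Type*} [TopologicalSpace P] [ChartedSpace EP P] [Group P] [LieGroup 𝓘(ℝ, EP) ∞ P]

/-- The Lie algebra `𝔭 ⊆ 𝔤` of `P`. -/
def ParabolicSubgroup.lieAlg (p : ParabolicSubgroup E G EP P) : Submodule ℝ (LieAlg E G) :=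
  LinearMap.range (p.dι : LieAlg EP P →ₗ[ℝ] LieAlg E G)

/-! ### Cartan geometries, the homogeneous model, local flatness -/

/-- A Cartan geometry of type `(G, P)` (a parabolic geometry), with total space `𝒢`.
The principal `P`-bundle `𝒢 → M` is given by a smooth free and proper right action of `P` on `𝒢`;
the base is the orbit space `M = 𝒢/P`. -/
structure CartanGeometry (p : ParabolicSubgroup E G EP P)
    (F : Type*) [NormedAddCommGroup F] [NormedSpace ℝ F]
    (𝒢 : Type*) [TopologicalSpace 𝒢] [ChartedSpace F 𝒢] [IsManifold 𝓘(ℝ, F) ∞ 𝒢] where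
  /-- the principal right action -/
  act : 𝒢 → P → 𝒢
  act_one : ∀ u, act u 1 = u
  act_mul : ∀ u h h', act u (h * h') = act (act u h) h'
  contMDiff_act :
    ContMDiff (𝓘(ℝ, F).prod 𝓘(ℝ, EP)) 𝓘(ℝ, F) ∞ (fun q : 𝒢 × P => act q.1 q.2)
  free : ∀ u h, act u h = u → h = 1
  proper : IsProperMap (fun q : 𝒢 × P => (q.1, act q.1 q.2))
  /-- the Cartan connection `θ ∈ Ω¹(𝒢, 𝔤)`, an isomorphism on each tangent space -/
  θ : ∀ u : 𝒢, TangentSpace 𝓘(ℝ, F) u ≃L[ℝ] LieAlg E G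
  /-- `θ` is smooth: the constant vector fields `θ⁻¹(X)` are smooth, i.e. the inverse of the
  trivialization `T𝒢 → 𝒢 × 𝔤` defined by `θ` is smooth -/
  contMDiff_θ_symm : ∀ X : LieAlg E G, ContMDiff 𝓘(ℝ, F) 𝓘(ℝ, F).tangent ∞
    (fun u : 𝒢 => (⟨u, (θ u).symm X⟩ : TangentBundle 𝓘(ℝ, F) 𝒢))
  /-- `(r^h)^* θ = Ad(h⁻¹) ∘ θ` -/
  θ_equivariant : ∀ (u : 𝒢) (h : P) (ξ : TangentSpace 𝓘(ℝ, F) u),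
    θ (act u h) (mfderiv 𝓘(ℝ, F) 𝓘(ℝ, F) (fun y => act y h) u ξ) = Ad (p.ι h)⁻¹ (θ u ξ)
  /-- `θ` reproduces the generators of the fundamental vector fields -/
  θ_fundamental : ∀ (u : 𝒢) (A : LieAlg EP P),
    θ (act u 1) (mfderiv 𝓘(ℝ, EP) 𝓘(ℝ, F) (fun h : P => act u h) 1 A) = p.dι A

lemma mdifferentiable_mul_left (g : G) :
    MDifferentiable 𝓘(ℝ, E) 𝓘(ℝ, E) (fun x : G => g * x) :=
  (contMDiff_mul_left (I := 𝓘(ℝ, E)) (n := ∞)).mdifferentiable (by simp)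

lemma mdifferentiable_mul_right (g : G) :
    MDifferentiable 𝓘(ℝ, E) 𝓘(ℝ, E) (fun x : G => x * g) :=
  (contMDiff_mul_right (I := 𝓘(ℝ, E)) (n := ∞)).mdifferentiable (by simp)

/-- Chain rule with values in the model spaces. -/
lemma mfderiv_comp_of_eq' {E₁ E₂ E₃ M₁ M₂ M₃ : Type*}
    [NormedAddCommGroup E₁] [NormedSpace ℝ E₁] [NormedAddCommGroup E₂] [NormedSpace ℝ E₂]
    [NormedAddCommGroup E₃] [NormedSpace ℝ E₃]
    [TopologicalSpace M₁] [ChartedSpace E₁ M₁] [TopologicalSpace M₂] [ChartedSpace E₂ M₂]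
    [TopologicalSpace M₃] [ChartedSpace E₃ M₃]
    {f : M₂ → M₃} {g : M₁ → M₂} {k : M₁ → M₃} {x : M₁} {y : M₂} (hy : g x = y)
    (hk : ∀ z, f (g z) = k z)
    (hf : MDifferentiableAt 𝓘(ℝ, E₂) 𝓘(ℝ, E₃) f y) (hg : MDifferentiableAt 𝓘(ℝ, E₁) 𝓘(ℝ, E₂) g x)
    (v : E₁) :
    (mfderiv 𝓘(ℝ, E₂) 𝓘(ℝ, E₃) f y : E₂ →L[ℝ] E₃)
      ((mfderiv 𝓘(ℝ, E₁) 𝓘(ℝ, E₂) g x : E₁ →L[ℝ] E₂) v)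
      = (mfderiv 𝓘(ℝ, E₁) 𝓘(ℝ, E₃) k x : E₁ →L[ℝ] E₃) v := by
  subst hy
  have : k = f ∘ g := funext fun z => (hk z).symm
  subst this
  exact (DFunLike.congr_fun (mfderiv_comp (I' := 𝓘(ℝ, E₂)) x hf hg) v).symm

/-- The left Maurer-Cartan form of `G`: `ξ ∈ T_gG` is mapped to `Tλ_{g⁻¹} ξ ∈ T₁G`; its inverse
maps `X` to the value at `g` of the left invariant vector field generated by `X`. -/
def maurerCartan (g : G) : TangentSpace 𝓘(ℝ, E) g ≃L[ℝ] LieAlg E G :=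
  ContinuousLinearEquiv.equivOfInverse
    (mfderiv 𝓘(ℝ, E) 𝓘(ℝ, E) (fun x : G => g⁻¹ * x) g : E →L[ℝ] E)
    (mfderiv 𝓘(ℝ, E) 𝓘(ℝ, E) (fun x : G => g * x) 1 : E →L[ℝ] E)
    (fun ξ => by
      refine (mfderiv_comp_of_eq' (E₁ := E) (E₂ := E) (E₃ := E) (f := fun x : G => g * x)
        (g := fun x : G => g⁻¹ * x) (x := g) (k := id) (by simp) (by simp)
        (mdifferentiable_mul_left g _) (mdifferentiable_mul_left g⁻¹ _) ξ).trans ?_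
      rw [mfderiv_id]; rfl)
    (fun X => by
      refine (mfderiv_comp_of_eq' (E₁ := E) (E₂ := E) (E₃ := E) (f := fun x : G => g⁻¹ * x)
        (g := fun x : G => g * x) (x := 1) (k := id) (by simp) (by simp)
        (mdifferentiable_mul_left g⁻¹ _) (mdifferentiable_mul_left g _) X).trans ?_
      rw [mfderiv_id]; rfl)

/-- Left invariant vector fields are smooth. -/
lemma contMDiff_maurerCartan_symm (X : LieAlg E G) : ContMDiff 𝓘(ℝ, E) 𝓘(ℝ, E).tangent ∞
    (fun g : G => (⟨g, (maurerCartan g).symm X⟩ : TangentBundle 𝓘(ℝ, E) G)) := by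
  let fg : G → TangentBundle 𝓘(ℝ, E) G := fun g => Bundle.TotalSpace.mk' E g 0
  have sfg : ContMDiff 𝓘(ℝ, E) 𝓘(ℝ, E).tangent ∞ fg := Bundle.contMDiff_zeroSection _ _
  let fv : G → TangentBundle 𝓘(ℝ, E) G := fun _ => Bundle.TotalSpace.mk' E 1 X
  have sfv : ContMDiff 𝓘(ℝ, E) 𝓘(ℝ, E).tangent ∞ fv := contMDiff_const
  have S₂ := (contMDiff_equivTangentBundleProd_symm (n := ∞) (I := 𝓘(ℝ, E)) (M := G)
    (I' := 𝓘(ℝ, E)) (M' := G)).comp (sfg.prodMk sfv)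
  have S₃ : ContMDiff (𝓘(ℝ, E).prod 𝓘(ℝ, E)).tangent 𝓘(ℝ, E).tangent ∞
      (tangentMap (𝓘(ℝ, E).prod 𝓘(ℝ, E)) 𝓘(ℝ, E) (fun q : G × G => q.1 * q.2)) :=
    (contMDiff_mul 𝓘(ℝ, E) ∞).contMDiff_tangentMap (m := ∞) (by simp)
  convert! S₃.comp S₂ with g
  · simp [fg, fv]
  · simp only [Function.comp_apply, tangentMap, fg, fv]
    rw [mfderiv_prod_eq_add_apply ((contMDiff_mul 𝓘(ℝ, E) ∞).mdifferentiableAt (by simp))]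
    exact ((congrArg₂ (· + ·) (map_zero _) rfl).trans (zero_add _)).symm

/-- The homogeneous model `G → G/P` with the Maurer-Cartan form. -/
def homogeneousModel (p : ParabolicSubgroup E G EP P) : CartanGeometry p E G where
  act g h := g * p.ι h
  act_one := by simp
  act_mul := by simp [mul_assoc]
  contMDiff_act := contMDiff_fst.mul (p.contMDiff_ι.comp contMDiff_snd)
  free u h hu := p.isClosedEmbedding_ι.injective (by simpa using hu)
  proper := by
    have : IsTopologicalGroup G := topologicalGroup_of_lieGroup 𝓘(ℝ, E) ∞
    have h1 : Topology.IsClosedEmbedding (fun q : G × P => (q.1, p.ι q.2)) :=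
      Topology.IsClosedEmbedding.id.prodMap p.isClosedEmbedding_ι
    exact ((Homeomorph.shearMulRight G).isClosedEmbedding.comp h1).isProperMap
  θ := maurerCartan
  contMDiff_θ_symm := contMDiff_maurerCartan_symm
  θ_equivariant u h ξ := by
    refine (mfderiv_comp_of_eq' (E₁ := E) (E₂ := E) (E₃ := E)
      (f := fun x : G => (u * p.ι h)⁻¹ * x) (g := fun x : G => x * p.ι h) (x := u)
      (k := fun x => (p.ι h)⁻¹ * (u⁻¹ * x) * (p.ι h)⁻¹⁻¹) rfl (by simp [mul_assoc])
      (mdifferentiable_mul_left _ _) (mdifferentiable_mul_right _ _) ξ).trans ?_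
    exact (mfderiv_comp_of_eq' (E₁ := E) (E₂ := E) (E₃ := E) (y := 1)
      (f := fun x : G => (p.ι h)⁻¹ * x * (p.ι h)⁻¹⁻¹) (g := fun x : G => u⁻¹ * x) (x := u)
      (k := fun x => (p.ι h)⁻¹ * (u⁻¹ * x) * (p.ι h)⁻¹⁻¹) (by simp) (fun _ => rfl)
      ((mdifferentiable_mul_right _ _).comp _ (mdifferentiable_mul_left _ _))
      (mdifferentiable_mul_left _ _) ξ).symm
  θ_fundamental u A := by
    rw [p.dι_eq]
    have hι : MDifferentiable 𝓘(ℝ, EP) 𝓘(ℝ, E) p.ι := p.contMDiff_ι.mdifferentiable (by simp)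
    exact mfderiv_comp_of_eq' (E₁ := EP) (E₂ := E) (E₃ := E)
      (f := fun x : G => (u * p.ι 1)⁻¹ * x) (g := fun h : P => u * p.ι h) (x := 1)
      (k := p.ι) rfl (by simp)
      (mdifferentiable_mul_left _ _) ((mdifferentiable_mul_left _ _).comp _ (hι _)) A

/-- A Cartan geometry is locally flat if it is locally isomorphic to the homogeneous model: each
point of `𝒢` has a `P`-invariant open neighbourhood (the preimage of an open subset of `M`) with a
`P`-equivariant diffeomorphism `Φ` onto an open subset of `G` that pulls back the Maurer-Cartan
form to the Cartan connection. (Smooth injections with invertible derivatives are diffeomorphisms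
onto open subsets.) -/
def CartanGeometry.LocallyFlat {p : ParabolicSubgroup E G EP P}
    {F : Type*} [NormedAddCommGroup F] [NormedSpace ℝ F]
    {𝒢 : Type*} [TopologicalSpace 𝒢] [ChartedSpace F 𝒢] [IsManifold 𝓘(ℝ, F) ∞ 𝒢] (𝒞 : CartanGeometry p F 𝒢) : Prop :=
  ∀ u : 𝒢, ∃ (U : Set 𝒢) (Φ : 𝒢 → G), u ∈ U ∧ IsOpen U ∧ (∀ y ∈ U, ∀ h, 𝒞.act y h ∈ U) ∧
    ContMDiffOn 𝓘(ℝ, F) 𝓘(ℝ, E) ∞ Φ U ∧ Set.InjOn Φ U ∧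
    (∀ y ∈ U, ∀ h, Φ (𝒞.act y h) = Φ y * p.ι h) ∧
    (∀ y ∈ U, ∀ ξ : TangentSpace 𝓘(ℝ, F) y,
      maurerCartan (Φ y) (mfderiv 𝓘(ℝ, F) 𝓘(ℝ, E) Φ y ξ) = 𝒞.θ y ξ)

/-! ### The modules inducing tractor bundles -/

/-- The algebraic datum inducing a tractor bundle, a `(𝔤, P)`-module: a (real or complex) vector
space `V` with a representation `ρ` of `𝔤` and a compatible smooth representation `σ` of `P`, that
is, `σ` is `P`-equivariantly intertwined with `ρ` and has derivative `ρ` on `𝔭`. The restriction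
of a representation of `G` with its derivative is an example. -/
structure TractorModule (p : ParabolicSubgroup E G EP P) (𝕜 : Type*) [RCLike 𝕜]
    (V : Type*) [NormedAddCommGroup V] [NormedSpace 𝕜 V] [NormedSpace ℝ V]
    [IsScalarTower ℝ 𝕜 V] where
  /-- the action of `𝔤` -/
  ρ : LieAlg E G →ₗ[ℝ] Module.End 𝕜 V
  ρ_lie : ∀ X Y v, ρ ⁅X, Y⁆ v = ρ X (ρ Y v) - ρ Y (ρ X v)
  /-- the action of `P` -/
  σ : P →* Module.End 𝕜 V
  contMDiff_σ : ∀ v, ContMDiff 𝓘(ℝ, EP) 𝓘(ℝ, V) ∞ (fun h => σ h v)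
  σ_ρ : ∀ h X v, σ h (ρ X v) = ρ (Ad (p.ι h) X) (σ h v)
  mfderiv_σ : ∀ (A : LieAlg EP P) (v : V),
    (mfderiv 𝓘(ℝ, EP) 𝓘(ℝ, V) (fun h => σ h v) 1 : EP →L[ℝ] V) A = ρ (p.dι A) v

/-! ### Differential forms with values in a tractor bundle, and operators on them -/

section Operators

variable {p : ParabolicSubgroup E G EP P}
  {F : Type*} [NormedAddCommGroup F] [NormedSpace ℝ F]
  {𝒢 : Type*} [TopologicalSpace 𝒢] [ChartedSpace F 𝒢] [IsManifold 𝓘(ℝ, F) ∞ 𝒢] (𝒞 : CartanGeometry p F 𝒢)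

/-- The fundamental derivative: for `f : 𝒢 → W` (a section of `𝒢 ×_P W` if `f` is equivariant),
`D f : 𝒢 → 𝔤^* ⊗ W` is the function with `(D f)(u)(X) = (θ_u⁻¹(X)) · f`. -/
def fundamentalDerivative {W : Type*} [NormedAddCommGroup W] [NormedSpace ℝ W] (f : 𝒢 → W)
    (u : 𝒢) : LieAlg E G →L[ℝ] W :=
  (mfderiv 𝓘(ℝ, F) 𝓘(ℝ, W) f u : TangentSpace 𝓘(ℝ, F) u →L[ℝ] W).comp
    ((𝒞.θ u).symm : LieAlg E G →L[ℝ] TangentSpace 𝓘(ℝ, F) u)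

/-- The curved Casimir operator `(B ⊗ id) ∘ D²`: the contraction of the iterated fundamental
derivative `D² f : 𝒢 → 𝔤^* ⊗ 𝔤^* ⊗ W` with the inverse Killing form. -/
def curvedCasimir [LieAlgebra.IsSemisimple ℝ (LieAlg E G)]
    {W : Type*} [NormedAddCommGroup W] [NormedSpace ℝ W] (f : 𝒢 → W) (u : 𝒢) : W :=
  ∑ l, fundamentalDerivative 𝒞 (fundamentalDerivative 𝒞 f) u
    (upperBasis (LieAlg E G) l) (lowerBasis (LieAlg E G) l)

variable {𝕜 : Type*} [RCLike 𝕜]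
  {V : Type*} [NormedAddCommGroup V] [NormedSpace 𝕜 V] [NormedSpace ℝ V] [IsScalarTower ℝ 𝕜 V]
  (T : TractorModule p 𝕜 V)

/-- The space `Ω^k(M, VM)` of smooth `k`-forms on `M = 𝒢/P` with values in the tractor bundle
`VM = 𝒢 ×_P V`, as smooth `P`-equivariant functions from `𝒢` to
`Λ^k(𝔤/𝔭)^* ⊗ V`, realized as the space of `V`-valued alternating maps on `𝔤` that vanish if an
argument lies in `𝔭`. -/
structure TractorForm (k : ℕ) where
  /-- the function on `𝒢` -/
  toFun : 𝒢 → LieAlg E G [⋀^Fin k]→L[ℝ] V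
  smooth : ContMDiff 𝓘(ℝ, F) 𝓘(ℝ, LieAlg E G [⋀^Fin k]→L[ℝ] V) ∞ toFun
  horizontal : ∀ u (X : Fin k → LieAlg E G), (∃ i, X i ∈ p.lieAlg) → toFun u X = 0
  equivariant : ∀ u h (X : Fin k → LieAlg E G),
    toFun (𝒞.act u h) X = T.σ h⁻¹ (toFun u fun i => Ad (p.ι h) (X i))

/-- The tractor connection, `∇_X f = D_X f + X • f`. -/
def tractorConnection (X : LieAlg E G) (f : 𝒢 → V) (u : 𝒢) : V :=
  fundamentalDerivative 𝒞 f u X + T.ρ X (f u)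

/-- The Lie bracket `[θ⁻¹(X), θ⁻¹(Y)]` of constant vector fields on `𝒢` at the point `u`, viewed as
an element of `𝔤` via `θ`. -/
def fieldBracket (u : 𝒢) (X Y : LieAlg E G) : LieAlg E G :=
  𝒞.θ u (VectorField.mlieBracket 𝓘(ℝ, F) (fun y => (𝒞.θ y).symm X) (fun y => (𝒞.θ y).symm Y) u)

/-- The bracket part
`∑_{i<j} (-1)^{i+j} φ([X_i, X_j], X_0, …, X̂_i, …, X̂_j, …, X_k)`
of the exterior derivative of a `k`-form. For `k = m + 1`, the pairs of indices are
`(i.castSucc, j.succ)` with `i ≤ j` in `Fin (m + 1)`. -/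
def bracketTerm (u : 𝒢) : {k : ℕ} → ((Fin k → LieAlg E G) → V) → (Fin (k + 1) → LieAlg E G) → V
  | 0, _, _ => 0
  | m + 1, φ, X => ∑ i : Fin (m + 1), ∑ j ∈ Finset.Ici i, (-1 : ℝ) ^ (i.castSucc + j.succ : ℕ) •
      φ (Fin.cons (fieldBracket 𝒞 u (X i.castSucc) (X j.succ))
        (j.removeNth (i.castSucc.removeNth X)))

/-- The covariant exterior derivative `d^∇ : Ω^k(M, VM) → Ω^{k+1}(M, VM)`: in the formula for
the exterior derivative, the actions of vector fields are replaced by the tractor connection: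
`∑_i (-1)^i ∇_{X_i}(φ(X_0, …, X̂_i, …, X_k))
  + ∑_{i<j} (-1)^{i+j} φ([X_i, X_j], X_0, …, X̂_i, …, X̂_j, …, X_k)`.
The `X_i` are the constant vector fields `θ⁻¹(X_i)` on `𝒢`; since the formula is tensorial in
the vector fields, it determines the value on the lifts to `𝒢` of vector fields on `M`. -/
def extCovDeriv {k : ℕ} (φ : 𝒢 → (Fin k → LieAlg E G) → V) (u : 𝒢)
    (X : Fin (k + 1) → LieAlg E G) : V :=
  ∑ i : Fin (k + 1), (-1 : ℝ) ^ (i : ℕ) • tractorConnection 𝒞 T (X i) (fun y => φ y (i.removeNth X)) u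
    + bracketTerm 𝒞 u (φ u) X

variable [LieAlgebra.IsSemisimple ℝ (LieAlg E G)]

/-- The operator `∂* : Ω^{k+1}(M, VM) → Ω^k(M, VM)`. -/
def codiff {k : ℕ} (φ : 𝒢 → (Fin (k + 1) → LieAlg E G) → V) (u : 𝒢) :
    (Fin k → LieAlg E G) → V :=
  codifferential T.ρ (φ u)

/-- The operator `□^R = ∂* ∘ d^∇ + d^∇ ∘ ∂*` on `Ω^k(M, VM)`, where `∂* = 0` on `Ω^0(M, VM)`. -/
def boxR : {k : ℕ} → (𝒢 → (Fin k → LieAlg E G) → V) → 𝒢 → (Fin k → LieAlg E G) → V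
  | 0, φ => codiff T (extCovDeriv 𝒞 T φ)
  | _ + 1, φ => codiff T (extCovDeriv 𝒞 T φ) + extCovDeriv 𝒞 T (codiff T φ)

end Operators

end Geometry

end

end CurvedCasimir

/-! Flatness enters only through the structure equation (`CartanGeometry.IsFlat`): X ↦ θ⁻¹(X)
preserves brackets. Hence the fundamental derivative D is a representation of 𝔤 on the smooth
V-valued functions on 𝒢. It commutes with the pointwise action ρ, so τ = D + ρ is a representation
too. A form is then an alternating map on 𝔤 with values in these functions, d^∇ is the
Chevalley-Eilenberg differential d of τ (`extCovDeriv_eq_chevalley`), and ∂* is -∑ (ρ(ξ^l) + ½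
ad*(ξ^l)) i(ξ_l), where ad* is `coadjₗ` and i is contraction (`codifferential_eq_homologyDiff`).
What remains is Lie algebra.

Write C(a, b) = ∑ a(ξ^l) b(ξ_l). Cartan's formula i(x) d + d i(x) = τ(x) + ad*(x), with the
commutators of ρ(x) and ad*(x) with d, gives □ = -C(ρ, τ) - C(τ, ad*) - ½ C(ad*, ad*)
(`homologyDiff_chevalley_add`). Put L = D + ρ + ad*. Completing the square yields 2□ = C(D, D) -
C(ρ, ρ) - C(L, L) (`two_smul_box`). Here C(D, D) is the curved Casimir operator, and C(ρ, ρ) is c₀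
because an eigenspace of the Casimir operator is an invariant subspace (`casimir_eq_smul`).

Finally C(L, L) kills every form φ. Differentiating P-equivariance gives L_a φ = 0 for a ∈ 𝔭
(`TractorForm.fundamentalDerivative_dι`). The Killing form pairs degree i with degree -i, so only
terms L_x L_y φ with x, y of opposite degrees occur. Either y ∈ 𝔭, or x ∈ 𝔭 and the term equals
L_[x,y] φ with [x, y] of degree 0, hence in 𝔭 (`sum_dual_eq_zero_of_isParabolic`).

The analytic input is that brackets of vector fields act on functions as commutators
(`mvfderiv_mlieBracket`) and that the derivative of Ad at 1 is the bracket (`mvfderiv_Ad`). -/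

namespace CurvedCasimir

set_option linter.unusedSectionVars false

/-! ### Alternating maps on a Lie algebra: coadjoint action, contraction, antisymmetrisation. -/

section AlternatingMaps

variable {𝔤 : Type*} [LieRing 𝔤] [LieAlgebra ℝ 𝔤] {M : Type*} [AddCommGroup M] [Module ℝ M]

/-- The action `(x · ψ)(Y) = -∑ ψ(…, ⁅x, Y_j⁆, …)` of `𝔤` on alternating maps on `𝔤`. -/
noncomputable def coadj {k : ℕ} (x : 𝔤) (ψ : 𝔤 [⋀^Fin k]→ₗ[ℝ] M) : 𝔤 [⋀^Fin k]→ₗ[ℝ] M where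
  toMultilinearMap := -∑ j, ψ.toMultilinearMap.compLinearMap
    (fun i => if i = j then (LieAlgebra.ad ℝ 𝔤 x : 𝔤 →ₗ[ℝ] 𝔤) else LinearMap.id)
  map_eq_zero_of_eq' Y a b hab hne := by
    have hval (j : Fin k) : (fun i => (if i = j then (LieAlgebra.ad ℝ 𝔤 x : 𝔤 →ₗ[ℝ] 𝔤)
        else LinearMap.id) (Y i)) = Function.update Y j ⁅x, Y j⁆ := by
      ext i
      by_cases h : i = j
      · subst h; simp
      · simp [h]
    simp only [neg_apply, sum_apply,
      MultilinearMap.compLinearMap_apply, AlternatingMap.coe_multilinearMap, hval, neg_eq_zero,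
      MultilinearMap.toFun_eq_coe]
    -- A summand with j outside {a, b} still has two equal arguments; the summands for a and b
    -- differ by a transposition and cancel.
    rw [← Finset.sum_subset (Finset.subset_univ {a, b}), Finset.sum_pair hne]
    · have h : Function.update Y b ⁅x, Y b⁆ = Function.update Y a ⁅x, Y a⁆ ∘ Equiv.swap a b := by
        ext i
        by_cases h1 : i = a
        · subst h1; simp [hne, hne.symm, hab]
        by_cases h2 : i = b
        · subst h2; simp [hab]
        · simp [h1, h2, Equiv.swap_apply_of_ne_of_ne]
      rw [h, ψ.map_swap _ hne, add_neg_cancel]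
    · intro j _ hj
      simp only [Finset.mem_insert, Finset.mem_singleton, not_or] at hj
      refine ψ.map_eq_zero_of_eq _ (i := a) (j := b) ?_ hne
      rw [Function.update_of_ne (Ne.symm hj.1), Function.update_of_ne (Ne.symm hj.2), hab]

lemma coadj_apply {k : ℕ} (x : 𝔤) (ψ : 𝔤 [⋀^Fin k]→ₗ[ℝ] M) (Y : Fin k → 𝔤) :
    coadj x ψ Y = -∑ j, ψ (Function.update Y j ⁅x, Y j⁆) := by
  change (-∑ j, ψ.toMultilinearMap.compLinearMap
    (fun i => if i = j then (LieAlgebra.ad ℝ 𝔤 x : 𝔤 →ₗ[ℝ] 𝔤) else LinearMap.id)) Y = _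
  simp only [neg_apply, sum_apply,
      MultilinearMap.compLinearMap_apply, AlternatingMap.coe_multilinearMap]
  congr 1
  refine Finset.sum_congr rfl fun j _ => congrArg ψ ?_
  ext i
  by_cases h : i = j
  · subst h; simp
  · simp [h]

/-- `coadj` as a bilinear map. -/
noncomputable def coadjₗ (𝔤 M : Type*) [LieRing 𝔤] [LieAlgebra ℝ 𝔤] [AddCommGroup M] [Module ℝ M]
    (k : ℕ) : 𝔤 →ₗ[ℝ] Module.End ℝ (𝔤 [⋀^Fin k]→ₗ[ℝ] M) :=
  LinearMap.mk₂ ℝ coadj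
    (fun x y ψ => by ext Y; simp [coadj_apply, Finset.sum_add_distrib]; abel)
    (fun c x ψ => by ext Y; simp [coadj_apply, Finset.smul_sum])
    (fun x ψ ψ' => by ext Y; simp [coadj_apply, Finset.sum_add_distrib]; abel)
    (fun c x ψ => by ext Y; simp [coadj_apply, Finset.smul_sum])

lemma coadjₗ_apply {k : ℕ} (x : 𝔤) (ψ : 𝔤 [⋀^Fin k]→ₗ[ℝ] M) (Y : Fin k → 𝔤) :
    coadjₗ 𝔤 M k x ψ Y = -∑ j, ψ (Function.update Y j ⁅x, Y j⁆) := coadj_apply x ψ Y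

lemma coadjₗ_zero (x : 𝔤) : coadjₗ 𝔤 M 0 x = 0 := by
  ext ψ Y; simp [coadjₗ_apply]

/-- The commutator rule [ad*(x), i(y)] = i([x, y]), obtained by separating slot 0 from the others.
It lets identities be proved by induction on the degree. -/
lemma curryLeft_coadjₗ {k : ℕ} (x y : 𝔤) (ψ : 𝔤 [⋀^Fin (k + 1)]→ₗ[ℝ] M) :
    (coadjₗ 𝔤 M (k + 1) x ψ).curryLeft y
      = coadjₗ 𝔤 M k x (ψ.curryLeft y) - ψ.curryLeft ⁅x, y⁆ := by
  ext Y
  simp only [AlternatingMap.curryLeft_apply_apply, AlternatingMap.sub_apply, coadjₗ_apply,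
    Fin.sum_univ_succ, Matrix.vecCons, Fin.cons_zero, Fin.update_cons_zero, Fin.cons_succ,
    ← Fin.cons_update]
  abel

lemma curryLeft_injective {k : ℕ} {ψ ψ' : 𝔤 [⋀^Fin (k + 1)]→ₗ[ℝ] M}
    (h : ∀ x, ψ.curryLeft x = ψ'.curryLeft x) : ψ = ψ' := by
  ext Y
  have := congrArg (fun f => f (Fin.tail Y)) (h (Y 0))
  simpa [Matrix.vecCons, AlternatingMap.curryLeft_apply_apply] using this

lemma curryLeft_sub {k : ℕ} (ψ ψ' : 𝔤 [⋀^Fin (k + 1)]→ₗ[ℝ] M) (x : 𝔤) :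
    (ψ - ψ').curryLeft x = ψ.curryLeft x - ψ'.curryLeft x := rfl

/-- Contraction with z reduces the degree. The correction terms produced by `curryLeft_coadjₗ` match
by the Jacobi identity. -/
lemma coadjₗ_lie {k : ℕ} (x y : 𝔤) (ψ : 𝔤 [⋀^Fin k]→ₗ[ℝ] M) :
    coadjₗ 𝔤 M k ⁅x, y⁆ ψ
      = coadjₗ 𝔤 M k x (coadjₗ 𝔤 M k y ψ) - coadjₗ 𝔤 M k y (coadjₗ 𝔤 M k x ψ) := by
  induction k with
  | zero => simp [coadjₗ_zero]
  | succ k ih =>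
    refine curryLeft_injective fun z => ?_
    simp only [map_sub, curryLeft_sub, curryLeft_coadjₗ, ih, lie_lie]
    abel

/-- Postcomposition of alternating maps with a linear family of endomorphisms. -/
noncomputable def post (𝔤 : Type*) [LieRing 𝔤] [LieAlgebra ℝ 𝔤] {M : Type*} [AddCommGroup M]
    [Module ℝ M] (k : ℕ) (τ : 𝔤 →ₗ[ℝ] Module.End ℝ M) :
    𝔤 →ₗ[ℝ] Module.End ℝ (𝔤 [⋀^Fin k]→ₗ[ℝ] M) :=
  LinearMap.mk₂ ℝ (fun x ψ => (τ x).compAlternatingMap ψ)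
    (fun x y ψ => by ext Y; simp)
    (fun c x ψ => by ext Y; simp)
    (fun x ψ ψ' => by ext Y; simp)
    (fun c x ψ => by ext Y; simp)

variable (τ τ' : 𝔤 →ₗ[ℝ] Module.End ℝ M)

@[simp] lemma post_apply {k : ℕ} (x : 𝔤) (ψ : 𝔤 [⋀^Fin k]→ₗ[ℝ] M) (Y : Fin k → 𝔤) :
    post 𝔤 k τ x ψ Y = τ x (ψ Y) := rfl

lemma curryLeft_post {k : ℕ} (x y : 𝔤) (ψ : 𝔤 [⋀^Fin (k + 1)]→ₗ[ℝ] M) :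
    (post 𝔤 (k + 1) τ x ψ).curryLeft y = post 𝔤 k τ x (ψ.curryLeft y) := rfl

lemma post_add (k : ℕ) : post 𝔤 k (τ + τ') = post 𝔤 k τ + post 𝔤 k τ' := by
  ext x ψ Y; simp

lemma post_coadjₗ {k : ℕ} (x y : 𝔤) (ψ : 𝔤 [⋀^Fin k]→ₗ[ℝ] M) :
    post 𝔤 k τ x (coadjₗ 𝔤 M k y ψ) = coadjₗ 𝔤 M k y (post 𝔤 k τ x ψ) := by
  ext Y; simp [coadjₗ_apply]

lemma post_comm {k : ℕ} (h : ∀ x y m, τ x (τ' y m) = τ' y (τ x m)) (x y : 𝔤)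
    (ψ : 𝔤 [⋀^Fin k]→ₗ[ℝ] M) :
    post 𝔤 k τ x (post 𝔤 k τ' y ψ) = post 𝔤 k τ' y (post 𝔤 k τ x ψ) := by
  ext Y; simp [h]

lemma post_lie {k : ℕ} (h : ∀ x y m, τ ⁅x, y⁆ m = τ x (τ y m) - τ y (τ x m)) (x y : 𝔤)
    (ψ : 𝔤 [⋀^Fin k]→ₗ[ℝ] M) :
    post 𝔤 k τ ⁅x, y⁆ ψ = post 𝔤 k τ x (post 𝔤 k τ y ψ) - post 𝔤 k τ y (post 𝔤 k τ x ψ) := by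
  ext Y; simp [h]

open AlternatingMap in
-- With x in slot 0, the summand of index 0 feeds x to f. In every other summand x stays in front of
-- the remaining arguments, and the index shift costs one sign.
lemma curryLeft_alternatizeUncurryFin {k : ℕ} (f : 𝔤 →ₗ[ℝ] 𝔤 [⋀^Fin (k + 1)]→ₗ[ℝ] M) (x : 𝔤) :
    (alternatizeUncurryFin f).curryLeft x
      = f x - alternatizeUncurryFin (curryLeftLinearMap.flip x ∘ₗ f) := by
  ext Y
  simp only [curryLeft_apply_apply, alternatizeUncurryFin_apply, Fin.sum_univ_succ (n := k + 1),
    AlternatingMap.sub_apply, Matrix.vecCons]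
  have h0 : (0 : Fin (k + 2)).removeNth (Fin.cons x Y : Fin (k + 2) → 𝔤) = Y := by
    ext a; simp [Fin.removeNth]
  have h (i : Fin (k + 1)) : (i.succ).removeNth (Fin.cons x Y : Fin (k + 2) → 𝔤)
      = Fin.cons x (i.removeNth Y) := by
    ext a; refine Fin.cases ?_ (fun b => ?_) a <;> simp [Fin.removeNth]
  simp [h0, h, sub_eq_add_neg, pow_succ, curryLeft_apply_apply, Matrix.vecCons]

open AlternatingMap in
lemma alternatizeUncurryFin_zero_apply (f : 𝔤 →ₗ[ℝ] 𝔤 [⋀^Fin 0]→ₗ[ℝ] M) (x : 𝔤) :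
    (alternatizeUncurryFin f).curryLeft x = f x := by
  ext Y
  simp [alternatizeUncurryFin_apply, curryLeft_apply_apply, Matrix.vecCons]

/-- Contracting `∑ (-1)^i ψ(f Y_i, …)`. -/
lemma alternatizeUncurryFin_curryLeft_ad {k : ℕ} (ψ : 𝔤 [⋀^Fin (k + 1)]→ₗ[ℝ] M) (x : 𝔤) :
    AlternatingMap.alternatizeUncurryFin (ψ.curryLeft ∘ₗ (LieAlgebra.ad ℝ 𝔤 x : 𝔤 →ₗ[ℝ] 𝔤))
      = -coadjₗ 𝔤 M (k + 1) x ψ := by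
  ext Y
  simp [AlternatingMap.alternatizeUncurryFin_apply, coadjₗ_apply,
    AlternatingMap.curryLeft_apply_apply]
  refine Finset.sum_congr rfl fun i _ => ?_
  -- Moving the bracket from the front to slot i costs (-1)^i, which cancels the sign of the
  -- antisymmetrisation.
  rw [← ψ.neg_one_pow_smul_map_insertNth, Fin.insertNth_removeNth, smul_smul, ← mul_pow]
  simp

/-- Bracketing with slot i hits either the argument fed to f, giving the `ad` term, or one of the
remaining arguments, giving `coadjₗ` of the value of f. -/
lemma coadjₗ_alternatizeUncurryFin {k : ℕ} (f : 𝔤 →ₗ[ℝ] 𝔤 [⋀^Fin k]→ₗ[ℝ] M) (x : 𝔤) :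
    coadjₗ 𝔤 M (k + 1) x (AlternatingMap.alternatizeUncurryFin f)
      = AlternatingMap.alternatizeUncurryFin
        (coadjₗ 𝔤 M k x ∘ₗ f - f ∘ₗ (LieAlgebra.ad ℝ 𝔤 x : 𝔤 →ₗ[ℝ] 𝔤)) := by
  ext Y
  simp only [AlternatingMap.alternatizeUncurryFin_apply, coadjₗ_apply]
  rw [Finset.sum_comm, ← Finset.sum_neg_distrib]
  refine Finset.sum_congr rfl fun i _ => ?_
  rw [Fin.sum_univ_succAbove _ i]
  simp [coadjₗ_apply, smul_sub, -Finset.sum_neg_distrib, Finset.smul_sum, Fin.removeNth_apply]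
  abel

end AlternatingMaps

/-! ### Contraction with the inverse Killing form, and its vanishing on parabolic-basic data. -/

section DualBases

variable {𝔤 : Type*} [LieRing 𝔤] [LieAlgebra ℝ 𝔤] [FiniteDimensional ℝ 𝔤]
  [LieAlgebra.IsKilling ℝ 𝔤] {N : Type*} [AddCommGroup N] [Module ℝ N]

lemma sum_killingForm_smul_lower (z : 𝔤) :
    ∑ l, killingForm ℝ 𝔤 (upperBasis 𝔤 l) z • lowerBasis 𝔤 l = z := by
  conv_rhs => rw [← (lowerBasis 𝔤).sum_repr z]
  refine Finset.sum_congr rfl fun l _ => ?_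
  congr 1
  conv_lhs => rw [← (lowerBasis 𝔤).sum_repr z, map_sum]
  simp_rw [map_smul, upperBasis, LinearMap.BilinForm.apply_dualBasis_left]
  simp

/-- The contraction of a bilinear map with the inverse Killing form is compatible with
adjoints. -/
lemma sum_dual_adjoint (b : 𝔤 →ₗ[ℝ] 𝔤 →ₗ[ℝ] N) (f g : 𝔤 →ₗ[ℝ] 𝔤)
    (h : ∀ x y, killingForm ℝ 𝔤 (f x) y = killingForm ℝ 𝔤 x (g y)) :
    ∑ l, b (f (upperBasis 𝔤 l)) (lowerBasis 𝔤 l)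
      = ∑ l, b (upperBasis 𝔤 l) (g (lowerBasis 𝔤 l)) := by
  have h1 (l) : b (f (upperBasis 𝔤 l)) (lowerBasis 𝔤 l)
      = ∑ m, killingForm ℝ 𝔤 (f (upperBasis 𝔤 l)) (lowerBasis 𝔤 m) •
          b (upperBasis 𝔤 m) (lowerBasis 𝔤 l) := by
    conv_lhs => rw [← sum_killingForm_smul (f (upperBasis 𝔤 l))]
    simp
  have h2 (l) : b (upperBasis 𝔤 l) (g (lowerBasis 𝔤 l))
      = ∑ m, killingForm ℝ 𝔤 (upperBasis 𝔤 m) (g (lowerBasis 𝔤 l)) •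
          b (upperBasis 𝔤 l) (lowerBasis 𝔤 m) := by
    conv_lhs => rw [← sum_killingForm_smul_lower (g (lowerBasis 𝔤 l))]
    simp
  simp_rw [h1, h2, h]
  exact Finset.sum_comm

/-- Expanding ξ_l in the basis ξ^m has the symmetric coefficients B(ξ_l, ξ_m), so the two bases may
be exchanged. -/
lemma sum_dual_symm (b : 𝔤 →ₗ[ℝ] 𝔤 →ₗ[ℝ] N) :
    ∑ l, b (upperBasis 𝔤 l) (lowerBasis 𝔤 l) = ∑ l, b (lowerBasis 𝔤 l) (upperBasis 𝔤 l) := by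
  have h1 (l) : b (upperBasis 𝔤 l) (lowerBasis 𝔤 l)
      = ∑ m, killingForm ℝ 𝔤 (lowerBasis 𝔤 l) (lowerBasis 𝔤 m) •
          b (upperBasis 𝔤 l) (upperBasis 𝔤 m) := by
    conv_lhs => rw [← sum_killingForm_smul (lowerBasis 𝔤 l)]
    simp
  have h2 (l) : b (lowerBasis 𝔤 l) (upperBasis 𝔤 l)
      = ∑ m, killingForm ℝ 𝔤 (lowerBasis 𝔤 l) (lowerBasis 𝔤 m) •
          b (upperBasis 𝔤 m) (upperBasis 𝔤 l) := by
    conv_lhs => rw [← sum_killingForm_smul (lowerBasis 𝔤 l)]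
    simp
  simp_rw [h1, h2]
  rw [Finset.sum_comm]
  refine Finset.sum_congr rfl fun l _ => Finset.sum_congr rfl fun m _ => ?_
  rw [LieModule.traceForm_comm]

/-- Invariance of the inverse Killing form: ad x is skew for B, so this is `sum_dual_adjoint` with
adjoint -ad x. -/
lemma sum_dual_lie (b : 𝔤 →ₗ[ℝ] 𝔤 →ₗ[ℝ] N) (x : 𝔤) :
    ∑ l, b ⁅x, upperBasis 𝔤 l⁆ (lowerBasis 𝔤 l)
      = -∑ l, b (upperBasis 𝔤 l) ⁅x, lowerBasis 𝔤 l⁆ := by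
  have := sum_dual_adjoint b (LieAlgebra.ad ℝ 𝔤 x) (-(LieAlgebra.ad ℝ 𝔤 x)) fun y z => by
    simp only [LieAlgebra.ad_apply, LinearMap.neg_apply, map_neg]
    rw [← lie_skew, map_neg, LinearMap.neg_apply, LieModule.traceForm_apply_lie_apply]
  simp only [LieAlgebra.ad_apply, LinearMap.neg_apply, map_neg, Finset.sum_neg_distrib] at this
  exact this

/-- If a bilinear map is invariant and basic with respect to a parabolic subalgebra, its
contraction with the inverse Killing form vanishes. -/
lemma sum_dual_eq_zero_of_isParabolic {𝔭 : Submodule ℝ 𝔤} (h𝔭 : IsParabolic 𝔭)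
    (b : 𝔤 →ₗ[ℝ] 𝔤 →ₗ[ℝ] N) (c : 𝔤 →ₗ[ℝ] N) (hb : ∀ x, ∀ a ∈ 𝔭, b x a = 0)
    (hbc : ∀ x y, b x y - b y x = c ⁅x, y⁆) (hc : ∀ a ∈ 𝔭, c a = 0) :
    ∑ l, b (upperBasis 𝔤 l) (lowerBasis 𝔤 l) = 0 := by
  obtain ⟨gr, hint, hgr, rfl⟩ := h𝔭
  classical
  have hp (i : ℤ) (hi : 0 ≤ i) : gr i ≤ ⨆ i : {i : ℤ // 0 ≤ i}, gr i :=
    le_iSup (fun i : {i : ℤ // 0 ≤ i} => gr i) ⟨i, hi⟩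
  -- The endomorphism ad x ∘ ad y shifts degrees by i + j ≠ 0, hence has trace zero.
  have horth (i j : ℤ) (hij : i + j ≠ 0) (x y : 𝔤) (hx : x ∈ gr i) (hy : y ∈ gr j) :
      killingForm ℝ 𝔤 x y = 0 := by
    rw [LieModule.traceForm_apply_apply]
    refine LinearMap.trace_eq_zero_of_mapsTo_ne hint (fun k => (i + j) + k) (fun k => by simpa) ?_
    intro k z hz
    have := hgr i (j + k) x hx _ (hgr j k y hy z hz)
    simpa [add_assoc] using this
  let e := (LinearEquiv.ofBijective (DirectSum.coeLinearMap gr) hint)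
  let π (i : ℤ) : 𝔤 →ₗ[ℝ] 𝔤 :=
    (gr i).subtype ∘ₗ DirectSum.component ℝ ℤ (fun i => gr i) i ∘ₗ e.symm.toLinearMap
  have hπmem (i x) : π i x ∈ gr i := (DirectSum.component ℝ ℤ (fun i => gr i) i (e.symm x)).2
  have hπsum (x : 𝔤) (S : Finset ℤ) (hS : (e.symm x).support ⊆ S) : ∑ i ∈ S, π i x = x := by
    conv_rhs => rw [← e.apply_symm_apply x]
    rw [← Finset.sum_subset hS]
    · change _ = DirectSum.coeLinearMap gr (e.symm x)
      rw [DirectSum.coeLinearMap_eq_dfinsuppSum]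
      rfl
    · intro i _ hi
      rw [DFinsupp.notMem_support_iff] at hi
      exact congrArg Subtype.val hi
  -- Both sides equal B(π₋ᵢ x, πᵢ y) by orthogonality. The set S contains i and -i so that the
  -- surviving index is always present in the sum.
  have hπadj (i : ℤ) (x y : 𝔤) : killingForm ℝ 𝔤 (π (-i) x) y = killingForm ℝ 𝔤 x (π i y) := by
    let S : Finset ℤ := insert i (insert (-i) ((e.symm x).support ∪ (e.symm y).support))
    trans killingForm ℝ 𝔤 (π (-i) x) (π i y)
    · conv_lhs => rw [← hπsum y S (by intro; simp +contextual [S])]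
      rw [map_sum, Finset.sum_eq_single i]
      · intro j _ hj
        exact horth _ _ (by omega) _ _ (hπmem _ _) (hπmem _ _)
      · simp [S]
    · conv_rhs => rw [← hπsum x S (by intro; simp +contextual [S])]
      rw [map_sum, LinearMap.sum_apply, Finset.sum_eq_single (-i)]
      · intro j _ hj
        exact horth _ _ (by omega) _ _ (hπmem _ _) (hπmem _ _)
      · simp [S]
  have hπidem (i : ℤ) (x : 𝔤) : π i (π i x) = π i x := by
    have : e (DirectSum.lof ℝ ℤ (fun i => gr i) i
        (DirectSum.component ℝ ℤ (fun i => gr i) i (e.symm x))) = π i x := by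
      exact DirectSum.coeLinearMap_lof gr i _
    conv_lhs => rw [← this]
    simp [π, DirectSum.component.lof_self]
  let S : Finset ℤ := Finset.univ.biUnion fun l => (e.symm (lowerBasis 𝔤 l)).support
  have hS (l) : b (upperBasis 𝔤 l) (lowerBasis 𝔤 l)
      = ∑ i ∈ S, b (upperBasis 𝔤 l) (π i (lowerBasis 𝔤 l)) := by
    rw [← map_sum, hπsum]
    exact Finset.subset_biUnion_of_mem (fun l => (e.symm (lowerBasis 𝔤 l)).support)
      (Finset.mem_univ l)
  simp_rw [hS]
  rw [Finset.sum_comm]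
  refine Finset.sum_eq_zero fun i _ => ?_
  -- Adjointness is applied to b(·, πᵢ ·); idempotence of πᵢ absorbs the second projection.
  have h1 : ∑ l, b (upperBasis 𝔤 l) (π i (lowerBasis 𝔤 l))
      = ∑ l, b (π (-i) (upperBasis 𝔤 l)) (π i (lowerBasis 𝔤 l)) := by
    have := sum_dual_adjoint (b.compl₂ (π i)) (π (-i)) (π i) (hπadj i)
    simpa [hπidem] using this.symm
  rw [h1]
  refine Finset.sum_eq_zero fun l _ => ?_
  -- For i ≥ 0 the second argument lies in 𝔭. For i < 0 the first one does; exchanging the arguments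
  -- costs c of a bracket of degree 0, which vanishes.
  rcases le_or_gt 0 i with hi | hi
  · exact hb _ _ (hp i hi (hπmem _ _))
  · have h2 := hbc (π (-i) (upperBasis 𝔤 l)) (π i (lowerBasis 𝔤 l))
    rw [hb _ _ (hp (-i) (by omega) (hπmem _ _)), sub_zero] at h2
    rw [h2]
    refine hc _ (hp 0 le_rfl ?_)
    simpa using hgr _ _ _ (hπmem (-i) (upperBasis 𝔤 l)) _ (hπmem i (lowerBasis 𝔤 l))

end DualBases

/-! ### Cartan calculus and the box operator as a combination of Casimir operators. -/

section BoxIdentity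

open AlternatingMap

variable {𝔤 : Type*} [LieRing 𝔤] [LieAlgebra ℝ 𝔤] {M : Type*} [AddCommGroup M] [Module ℝ M]

/-- The Chevalley-Eilenberg differential for the representation `τ` of `𝔤` on `M`. -/
noncomputable def chevalley (τ : 𝔤 →ₗ[ℝ] Module.End ℝ M) {k : ℕ} (ψ : 𝔤 [⋀^Fin k]→ₗ[ℝ] M) :
    𝔤 [⋀^Fin (k + 1)]→ₗ[ℝ] M :=
  -- The factor 1/2 compensates for each pair of arguments being bracketed twice, once from each of
  -- its two indices.
  alternatizeUncurryFin ((post 𝔤 k τ).flip ψ + (1 / 2 : ℝ) • (coadjₗ 𝔤 M k).flip ψ)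

lemma chevalley_add (τ : 𝔤 →ₗ[ℝ] Module.End ℝ M) {k : ℕ} (ψ ψ' : 𝔤 [⋀^Fin k]→ₗ[ℝ] M) :
    chevalley τ (ψ + ψ') = chevalley τ ψ + chevalley τ ψ' := by
  rw [chevalley, chevalley, chevalley, ← alternatizeUncurryFin_add]
  congr 1
  simp only [map_add, smul_add]
  abel

lemma chevalley_smul (τ : 𝔤 →ₗ[ℝ] Module.End ℝ M) {k : ℕ} (c : ℝ) (ψ : 𝔤 [⋀^Fin k]→ₗ[ℝ] M) :
    chevalley τ (c • ψ) = c • chevalley τ ψ := by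
  rw [chevalley, chevalley, ← alternatizeUncurryFin_smul]
  congr 1
  simp only [map_smul, smul_add, smul_comm c]

lemma chevalley_neg (τ : 𝔤 →ₗ[ℝ] Module.End ℝ M) {k : ℕ} (ψ : 𝔤 [⋀^Fin k]→ₗ[ℝ] M) :
    chevalley τ (-ψ) = -chevalley τ ψ := by
  simpa using chevalley_smul τ (-1) ψ

lemma chevalley_sum (τ : 𝔤 →ₗ[ℝ] Module.End ℝ M) {k : ℕ} {ι : Type*} (s : Finset ι)
    (ψ : ι → 𝔤 [⋀^Fin k]→ₗ[ℝ] M) : chevalley τ (∑ i ∈ s, ψ i) = ∑ i ∈ s, chevalley τ (ψ i) :=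
  map_sum (AddMonoidHom.mk' (chevalley τ) (chevalley_add τ)) ψ s

lemma curryLeft_chevalley_zero (τ : 𝔤 →ₗ[ℝ] Module.End ℝ M) (ψ : 𝔤 [⋀^Fin 0]→ₗ[ℝ] M) (x : 𝔤) :
    (chevalley τ ψ).curryLeft x = post 𝔤 0 τ x ψ := by
  rw [chevalley, alternatizeUncurryFin_zero_apply]
  simp [coadjₗ_zero]

/-- Cartan's formula. -/
lemma curryLeft_chevalley (τ : 𝔤 →ₗ[ℝ] Module.End ℝ M) {k : ℕ} (ψ : 𝔤 [⋀^Fin (k + 1)]→ₗ[ℝ] M)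
    (x : 𝔤) : (chevalley τ ψ).curryLeft x
      = post 𝔤 (k + 1) τ x ψ + coadjₗ 𝔤 M (k + 1) x ψ - chevalley τ (ψ.curryLeft x) := by
  -- Contraction with x commutes with ½ ad*(y) up to ½ ψ([x, y], …). Antisymmetrised in y, this
  -- error supplies the missing half of ad*(x) ψ.
  have h : curryLeftLinearMap.flip x ∘ₗ
      ((post 𝔤 (k + 1) τ).flip ψ + (1 / 2 : ℝ) • (coadjₗ 𝔤 M (k + 1)).flip ψ)
      = ((post 𝔤 k τ).flip (ψ.curryLeft x) + (1 / 2 : ℝ) • (coadjₗ 𝔤 M k).flip (ψ.curryLeft x))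
        + (1 / 2 : ℝ) • (ψ.curryLeft ∘ₗ (LieAlgebra.ad ℝ 𝔤 x : 𝔤 →ₗ[ℝ] 𝔤)) := by
    refine LinearMap.ext fun y => ?_
    simp only [LinearMap.comp_apply, LinearMap.add_apply, LinearMap.smul_apply,
      LinearMap.flip_apply, map_add, map_smul, LieAlgebra.ad_apply]
    change (post 𝔤 (k + 1) τ y ψ).curryLeft x
      + (1 / 2 : ℝ) • (coadjₗ 𝔤 M (k + 1) y ψ).curryLeft x = _
    rw [curryLeft_post, curryLeft_coadjₗ, ← lie_skew x y, map_neg]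
    module
  rw [chevalley, curryLeft_alternatizeUncurryFin, h, alternatizeUncurryFin_add,
    alternatizeUncurryFin_smul, alternatizeUncurryFin_curryLeft_ad, chevalley]
  simp only [LinearMap.add_apply, LinearMap.smul_apply, LinearMap.flip_apply]
  module

lemma post_alternatizeUncurryFin (τ : 𝔤 →ₗ[ℝ] Module.End ℝ M) {k : ℕ}
    (f : 𝔤 →ₗ[ℝ] 𝔤 [⋀^Fin k]→ₗ[ℝ] M) (x : 𝔤) :
    post 𝔤 (k + 1) τ x (alternatizeUncurryFin f)
      = alternatizeUncurryFin (post 𝔤 k τ x ∘ₗ f) := by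
  ext Y
  simp [alternatizeUncurryFin_apply]

/-- The hypothesis says that ρ is equivariant for τ, as holds for τ = D + ρ. So ρ(x) fails to
commute with d exactly by the terms ρ([x, Y_i]). -/
lemma post_chevalley (τ ρ : 𝔤 →ₗ[ℝ] Module.End ℝ M)
    (h : ∀ x y m, τ x (ρ y m) - ρ y (τ x m) = ρ ⁅x, y⁆ m) {k : ℕ}
    (ψ : 𝔤 [⋀^Fin k]→ₗ[ℝ] M) (x : 𝔤) :
    post 𝔤 (k + 1) ρ x (chevalley τ ψ) = chevalley τ (post 𝔤 k ρ x ψ)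
      + alternatizeUncurryFin ((post 𝔤 k ρ).flip ψ ∘ₗ (LieAlgebra.ad ℝ 𝔤 x : 𝔤 →ₗ[ℝ] 𝔤)) := by
  rw [chevalley, chevalley, post_alternatizeUncurryFin, ← alternatizeUncurryFin_add]
  congr 1
  refine LinearMap.ext fun y => ?_
  simp only [LinearMap.comp_apply, LinearMap.add_apply, LinearMap.smul_apply,
    LinearMap.flip_apply, map_add, map_smul, LieAlgebra.ad_apply, post_coadjₗ]
  have : post 𝔤 k ρ x (post 𝔤 k τ y ψ)
      = post 𝔤 k τ y (post 𝔤 k ρ x ψ) + post 𝔤 k ρ ⁅x, y⁆ ψ := by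
    ext Y
    simp only [post_apply, AlternatingMap.add_apply]
    rw [← lie_skew, map_neg, LinearMap.neg_apply, ← h]
    abel
  rw [this]
  abel

/-- The coadjoint action respects d except that it moves the argument of τ: the full Lie derivative
would compensate by τ(x), and ad*(x) alone leaves the terms τ([x, Y_i]). -/
lemma coadjₗ_chevalley (τ : 𝔤 →ₗ[ℝ] Module.End ℝ M) {k : ℕ}
    (ψ : 𝔤 [⋀^Fin k]→ₗ[ℝ] M) (x : 𝔤) :
    coadjₗ 𝔤 M (k + 1) x (chevalley τ ψ) = chevalley τ (coadjₗ 𝔤 M k x ψ)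
      - alternatizeUncurryFin ((post 𝔤 k τ).flip ψ ∘ₗ (LieAlgebra.ad ℝ 𝔤 x : 𝔤 →ₗ[ℝ] 𝔤)) := by
  rw [chevalley, chevalley, coadjₗ_alternatizeUncurryFin, eq_sub_iff_add_eq,
    ← alternatizeUncurryFin_add]
  congr 1
  refine LinearMap.ext fun y => ?_
  simp only [LinearMap.comp_apply, LinearMap.add_apply, LinearMap.smul_apply, LinearMap.sub_apply,
    LinearMap.flip_apply, map_add, map_smul, LieAlgebra.ad_apply, post_coadjₗ, coadjₗ_lie]
  module

variable [FiniteDimensional ℝ 𝔤] [LieAlgebra.IsKilling ℝ 𝔤]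

/-- The contraction `∑ a(ξ^l) b(ξ_l)`. -/
noncomputable def dualSum {N : Type*} [AddCommGroup N] [Module ℝ N]
    (a b : 𝔤 →ₗ[ℝ] Module.End ℝ N) : Module.End ℝ N :=
  ∑ l, a (upperBasis 𝔤 l) * b (lowerBasis 𝔤 l)

lemma dualSum_apply {N : Type*} [AddCommGroup N] [Module ℝ N]
    (a b : 𝔤 →ₗ[ℝ] Module.End ℝ N) (n : N) :
    dualSum a b n = ∑ l, a (upperBasis 𝔤 l) (b (lowerBasis 𝔤 l) n) := by
  simp [dualSum]

lemma dualSum_add_left {N : Type*} [AddCommGroup N] [Module ℝ N]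
    (a a' b : 𝔤 →ₗ[ℝ] Module.End ℝ N) : dualSum (a + a') b = dualSum a b + dualSum a' b := by
  simp [dualSum, add_mul, Finset.sum_add_distrib]

lemma dualSum_add_right {N : Type*} [AddCommGroup N] [Module ℝ N]
    (a b b' : 𝔤 →ₗ[ℝ] Module.End ℝ N) : dualSum a (b + b') = dualSum a b + dualSum a b' := by
  simp [dualSum, mul_add, Finset.sum_add_distrib]

lemma dualSum_comm {N : Type*} [AddCommGroup N] [Module ℝ N]
    (a b : 𝔤 →ₗ[ℝ] Module.End ℝ N) (h : ∀ x y n, a x (b y n) = b y (a x n)) :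
    dualSum a b = dualSum b a := by
  have := sum_dual_symm ((LinearMap.mul ℝ (Module.End ℝ N)).compl₁₂ a b)
  simp only [LinearMap.compl₁₂_apply, LinearMap.mul_apply'] at this
  rw [dualSum, dualSum, this]
  exact Finset.sum_congr rfl fun l _ => LinearMap.ext fun n => h _ _ n

/-- The Lie algebra homology differential on alternating maps. -/
noncomputable def homologyDiff (ρ : 𝔤 →ₗ[ℝ] Module.End ℝ M) {k : ℕ}
    (ψ : 𝔤 [⋀^Fin (k + 1)]→ₗ[ℝ] M) : 𝔤 [⋀^Fin k]→ₗ[ℝ] M :=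
  -∑ l, (post 𝔤 k ρ (upperBasis 𝔤 l) (ψ.curryLeft (lowerBasis 𝔤 l))
    + (1 / 2 : ℝ) • coadjₗ 𝔤 M k (upperBasis 𝔤 l) (ψ.curryLeft (lowerBasis 𝔤 l)))

/-- Evaluates the error terms of the two preceding commutators after contraction. Invariance moves
the bracket from ξ^l to ξ_l, where antisymmetrisation turns it into the coadjoint action. -/
lemma sum_alternatizeUncurryFin_ad (τ : 𝔤 →ₗ[ℝ] Module.End ℝ M) {k : ℕ}
    (ψ : 𝔤 [⋀^Fin (k + 1)]→ₗ[ℝ] M) :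
    ∑ l, alternatizeUncurryFin ((post 𝔤 k τ).flip (ψ.curryLeft (lowerBasis 𝔤 l)) ∘ₗ
        (LieAlgebra.ad ℝ 𝔤 (upperBasis 𝔤 l) : 𝔤 →ₗ[ℝ] 𝔤))
      = dualSum (post 𝔤 (k + 1) τ) (coadjₗ 𝔤 M (k + 1)) ψ := by
  have h : ∑ l, (post 𝔤 k τ).flip (ψ.curryLeft (lowerBasis 𝔤 l)) ∘ₗ
        (LieAlgebra.ad ℝ 𝔤 (upperBasis 𝔤 l) : 𝔤 →ₗ[ℝ] 𝔤)
      = -∑ l, post 𝔤 k τ (upperBasis 𝔤 l) ∘ₗ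
        (ψ.curryLeft ∘ₗ (LieAlgebra.ad ℝ 𝔤 (lowerBasis 𝔤 l) : 𝔤 →ₗ[ℝ] 𝔤)) := by
    refine LinearMap.ext fun y => ?_
    have := sum_dual_lie (((post 𝔤 k τ).flip ∘ₗ ψ.curryLeft).flip) y
    simp only [LinearMap.flip_apply, LinearMap.comp_apply] at this
    simp only [LinearMap.sum_apply, LinearMap.neg_apply, LinearMap.flip_apply,
      LinearMap.comp_apply, LieAlgebra.ad_apply]
    simp_rw [← lie_skew _ y, map_neg, LinearMap.neg_apply, Finset.sum_neg_distrib]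
    rw [neg_neg, this, neg_neg]
  change ∑ l, alternatizeUncurryFinLM _ = _
  rw [← map_sum, h, map_neg, map_sum, dualSum_apply, ← Finset.sum_neg_distrib]
  refine Finset.sum_congr rfl fun l _ => ?_
  change -alternatizeUncurryFin _ = _
  rw [← post_alternatizeUncurryFin, alternatizeUncurryFin_curryLeft_ad, map_neg, neg_neg]

lemma homologyDiff_chevalley_zero (τ ρ : 𝔤 →ₗ[ℝ] Module.End ℝ M) (ψ : 𝔤 [⋀^Fin 0]→ₗ[ℝ] M) :
    homologyDiff ρ (chevalley τ ψ) = -dualSum (post 𝔤 0 ρ) (post 𝔤 0 τ) ψ := by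
  simp [homologyDiff, curryLeft_chevalley_zero, coadjₗ_zero, dualSum_apply]

/-- By Cartan's formula the terms containing d combine into commutators of d with ρ(ξ^l) + ½
ad*(ξ^l). These contribute C(ρ, ad*) - ½ C(τ, ad*), cancelling the C(ρ, ad*) coming from the Lie
derivative. -/
lemma homologyDiff_chevalley_add (τ ρ : 𝔤 →ₗ[ℝ] Module.End ℝ M)
    (h : ∀ x y m, τ x (ρ y m) - ρ y (τ x m) = ρ ⁅x, y⁆ m) {k : ℕ}
    (ψ : 𝔤 [⋀^Fin (k + 1)]→ₗ[ℝ] M) :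
    homologyDiff ρ (chevalley τ ψ) + chevalley τ (homologyDiff ρ ψ)
      = -dualSum (post 𝔤 (k + 1) ρ) (post 𝔤 (k + 1) τ) ψ
        - dualSum (post 𝔤 (k + 1) τ) (coadjₗ 𝔤 M (k + 1)) ψ
        - (1 / 2 : ℝ) • dualSum (coadjₗ 𝔤 M (k + 1)) (coadjₗ 𝔤 M (k + 1)) ψ := by
  rw [dualSum_comm (post 𝔤 (k + 1) τ) (coadjₗ 𝔤 M (k + 1)) fun x y n => post_coadjₗ τ x y n]
  have h1 := sum_alternatizeUncurryFin_ad ρ ψ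
  have h2 := sum_alternatizeUncurryFin_ad τ ψ
  rw [dualSum_comm (post 𝔤 (k + 1) τ) (coadjₗ 𝔤 M (k + 1)) fun x y n => post_coadjₗ τ x y n] at h2
  simp only [homologyDiff, chevalley_neg, chevalley_sum, chevalley_add, chevalley_smul,
    curryLeft_chevalley, map_sub, map_add, post_chevalley τ ρ h, coadjₗ_chevalley, smul_sub,
    smul_add, Finset.sum_add_distrib, Finset.sum_sub_distrib, ← Finset.smul_sum, h1, h2,
    ← dualSum_apply]
  module

/-- The box operator in terms of Casimir operators. -/
theorem two_smul_box (D ρ : 𝔤 →ₗ[ℝ] Module.End ℝ M)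
    (hρ : ∀ x y m, ρ ⁅x, y⁆ m = ρ x (ρ y m) - ρ y (ρ x m))
    (hDρ : ∀ x y m, D x (ρ y m) = ρ y (D x m)) {k : ℕ} (ψ : 𝔤 [⋀^Fin (k + 1)]→ₗ[ℝ] M) :
    (2 : ℝ) • (homologyDiff ρ (chevalley (D + ρ) ψ) + chevalley (D + ρ) (homologyDiff ρ ψ))
      = dualSum (post 𝔤 (k + 1) D) (post 𝔤 (k + 1) D) ψ
        - dualSum (post 𝔤 (k + 1) ρ) (post 𝔤 (k + 1) ρ) ψ
        - dualSum (post 𝔤 (k + 1) (D + ρ) + coadjₗ 𝔤 M (k + 1))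
          (post 𝔤 (k + 1) (D + ρ) + coadjₗ 𝔤 M (k + 1)) ψ := by
  rw [homologyDiff_chevalley_add]
  · simp only [post_add, dualSum_add_left, dualSum_add_right, LinearMap.add_apply]
    rw [dualSum_comm (coadjₗ 𝔤 M (k + 1)) (post 𝔤 (k + 1) D) fun x y n => (post_coadjₗ D y x n).symm,
      dualSum_comm (coadjₗ 𝔤 M (k + 1)) (post 𝔤 (k + 1) ρ) fun x y n => (post_coadjₗ ρ y x n).symm,
      dualSum_comm (post 𝔤 (k + 1) ρ) (post 𝔤 (k + 1) D)
        fun x y n => (post_comm D ρ hDρ y x n).symm]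
    module
  · intro x y m
    simp only [LinearMap.add_apply, map_add, hDρ, hρ]
    abel

/-- In degree 0 there is no d∂* term and the coadjoint action vanishes; it is kept in the formula so
that both degrees are finished in the same way. -/
theorem two_smul_box_zero (D ρ : 𝔤 →ₗ[ℝ] Module.End ℝ M)
    (hDρ : ∀ x y m, D x (ρ y m) = ρ y (D x m)) (ψ : 𝔤 [⋀^Fin 0]→ₗ[ℝ] M) :
    (2 : ℝ) • homologyDiff ρ (chevalley (D + ρ) ψ)
      = dualSum (post 𝔤 0 D) (post 𝔤 0 D) ψ - dualSum (post 𝔤 0 ρ) (post 𝔤 0 ρ) ψ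
        - dualSum (post 𝔤 0 (D + ρ) + coadjₗ 𝔤 M 0) (post 𝔤 0 (D + ρ) + coadjₗ 𝔤 M 0) ψ := by
  have h0 : coadjₗ 𝔤 M 0 = 0 := LinearMap.ext coadjₗ_zero
  rw [homologyDiff_chevalley_zero]
  simp only [h0, add_zero, post_add, dualSum_add_left, dualSum_add_right, LinearMap.add_apply]
  rw [dualSum_comm (post 𝔤 0 ρ) (post 𝔤 0 D) fun x y n => (post_comm D ρ hDρ y x n).symm]
  module

/-- The Casimir operator of the Lie derivative vanishes on basic elements. -/
theorem dualSum_eq_zero_of_basic (τ : 𝔤 →ₗ[ℝ] Module.End ℝ M)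
    (hτ : ∀ x y m, τ ⁅x, y⁆ m = τ x (τ y m) - τ y (τ x m)) {𝔭 : Submodule ℝ 𝔤}
    (h𝔭 : IsParabolic 𝔭) {k : ℕ} (ψ : 𝔤 [⋀^Fin k]→ₗ[ℝ] M)
    (hψ : ∀ a ∈ 𝔭, (post 𝔤 k τ + coadjₗ 𝔤 M k) a ψ = 0) :
    dualSum (post 𝔤 k τ + coadjₗ 𝔤 M k) (post 𝔤 k τ + coadjₗ 𝔤 M k) ψ = 0 := by
  rw [dualSum_apply]
  set L := post 𝔤 k τ + coadjₗ 𝔤 M k with hL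
  refine sum_dual_eq_zero_of_isParabolic h𝔭 (L.compl₂ (L.flip ψ)) (L.flip ψ) ?_ ?_ hψ
  · intro x a ha
    have := hψ a ha
    simp_all
  · intro x y
    change L x (L y ψ) - L y (L x ψ) = L ⁅x, y⁆ ψ
    simp only [hL, LinearMap.add_apply, map_add, post_lie τ hτ, coadjₗ_lie, post_coadjₗ]
    abel

end BoxIdentity

/-! ### Brackets of vector fields as commutators of derivations. -/

section Derivations

open VectorField Filter Topology

variable {F : Type*} [NormedAddCommGroup F] [NormedSpace ℝ F]
  {N : Type*} [TopologicalSpace N] [ChartedSpace F N]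

lemma mvfderiv_clm_comp {W W' : Type*} [NormedAddCommGroup W] [NormedSpace ℝ W]
    [NormedAddCommGroup W'] [NormedSpace ℝ W'] (L : W →L[ℝ] W') {f : N → W} {x : N}
    (hf : MDifferentiableAt 𝓘(ℝ, F) 𝓘(ℝ, W) f x) (v : TangentSpace 𝓘(ℝ, F) x) :
    mvfderiv 𝓘(ℝ, F) (fun y => L (f y)) x v = L (mvfderiv 𝓘(ℝ, F) f x v) := by
  have h := mfderiv_comp (I' := 𝓘(ℝ, W)) x L.differentiableAt.mdifferentiableAt hf
  have h' : (mfderiv 𝓘(ℝ, F) 𝓘(ℝ, W') (L ∘ f) x) v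
      = (mfderiv 𝓘(ℝ, W) 𝓘(ℝ, W') L (f x)) ((mfderiv 𝓘(ℝ, F) 𝓘(ℝ, W) f x) v) := by rw [h]; rfl
  rw [mfderiv_eq_fderiv, L.fderiv] at h'
  exact h'

variable [IsManifold 𝓘(ℝ, F) ∞ N]

lemma contMDiffOn_mvfderiv_apply {W : Type*} [NormedAddCommGroup W] [NormedSpace ℝ W]
    {f : N → W} {s : Set N} (hs : IsOpen s) (hf : ContMDiffOn 𝓘(ℝ, F) 𝓘(ℝ, W) ∞ f s)
    {X : ∀ x : N, TangentSpace 𝓘(ℝ, F) x}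
    (hX : ContMDiff 𝓘(ℝ, F) 𝓘(ℝ, F).tangent ∞ (fun x => (⟨x, X x⟩ : TangentBundle 𝓘(ℝ, F) N))) :
    ContMDiffOn 𝓘(ℝ, F) 𝓘(ℝ, W) ∞ (fun x => mvfderiv 𝓘(ℝ, F) f x (X x)) s := by
  have h1 := hf.contMDiffOn_tangentMapWithin (m := ∞) (by simp) hs.uniqueMDiffOn
  have h2 := (contMDiff_snd_tangentBundle_modelSpace W 𝓘(ℝ, W) (n := ∞)).comp_contMDiffOn
    (h1.comp (hX.contMDiffOn (s := s)) fun x hx => hx)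
  refine h2.congr fun x hx => ?_
  change _ = mfderivWithin 𝓘(ℝ, F) 𝓘(ℝ, W) f s x (X x)
  rw [mfderivWithin_of_isOpen hs hx]
  rfl

variable [CompleteSpace F]

/-- The Lie bracket of vector fields acts on functions as the commutator. -/
lemma mvfderiv_mlieBracket_real {f : N → ℝ} {s : Set N} (hs : IsOpen s)
    (hf : ContMDiffOn 𝓘(ℝ, F) 𝓘(ℝ, ℝ) ∞ f s) {X Y Z : ∀ x : N, TangentSpace 𝓘(ℝ, F) x}
    (hX : ContMDiff 𝓘(ℝ, F) 𝓘(ℝ, F).tangent ∞ (fun x => (⟨x, X x⟩ : TangentBundle 𝓘(ℝ, F) N)))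
    (hY : ContMDiff 𝓘(ℝ, F) 𝓘(ℝ, F).tangent ∞ (fun x => (⟨x, Y x⟩ : TangentBundle 𝓘(ℝ, F) N)))
    (hZ : ContMDiff 𝓘(ℝ, F) 𝓘(ℝ, F).tangent ∞ (fun x => (⟨x, Z x⟩ : TangentBundle 𝓘(ℝ, F) N)))
    {x : N} (hx : x ∈ s) (hZx : Z x ≠ 0) :
    mvfderiv 𝓘(ℝ, F) f x (mlieBracket 𝓘(ℝ, F) X Y x)
      = mvfderiv 𝓘(ℝ, F) (fun y => mvfderiv 𝓘(ℝ, F) f y (Y y)) x (X x)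
        - mvfderiv 𝓘(ℝ, F) (fun y => mvfderiv 𝓘(ℝ, F) f y (X y)) x (Y x) := by
  have : IsManifold 𝓘(ℝ, F) (minSmoothness ℝ 3) N := IsManifold.of_le (n := ∞) (by
    rw [minSmoothness_of_isRCLikeNormedField]; exact WithTop.coe_le_coe.2 le_top)
  have : IsManifold 𝓘(ℝ, F) 2 N := IsManifold.of_le (n := ∞) (WithTop.coe_le_coe.2 le_top)
  have : IsManifold 𝓘(ℝ, F) (∞ + 1) N := by simpa
  have hbr {A B : ∀ x : N, TangentSpace 𝓘(ℝ, F) x}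
    (hA : ContMDiff 𝓘(ℝ, F) 𝓘(ℝ, F).tangent ∞ (fun x => (⟨x, A x⟩ : TangentBundle 𝓘(ℝ, F) N)))
    (hB : ContMDiff 𝓘(ℝ, F) 𝓘(ℝ, F).tangent ∞ (fun x => (⟨x, B x⟩ : TangentBundle 𝓘(ℝ, F) N))) :
      ContMDiff 𝓘(ℝ, F) 𝓘(ℝ, F).tangent ∞
        (fun x => (⟨x, mlieBracket 𝓘(ℝ, F) A B x⟩ : TangentBundle 𝓘(ℝ, F) N)) :=
    ContDiff.mlieBracket_vectorField (m := ⊤) (n := ⊤) hA hB (by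
      rw [minSmoothness_of_isRCLikeNormedField]; exact WithTop.coe_le_coe.2 le_top)
  have hmd {A : ∀ x : N, TangentSpace 𝓘(ℝ, F) x}
    (hA : ContMDiff 𝓘(ℝ, F) 𝓘(ℝ, F).tangent ∞ (fun x => (⟨x, A x⟩ : TangentBundle 𝓘(ℝ, F) N)))
    (y : N) : MDifferentiableAt 𝓘(ℝ, F) 𝓘(ℝ, F).tangent
      (fun x => (⟨x, A x⟩ : TangentBundle 𝓘(ℝ, F) N)) y := hA.mdifferentiable (by simp) y
  have hfd {g : N → ℝ} (hg : ContMDiffOn 𝓘(ℝ, F) 𝓘(ℝ, ℝ) ∞ g s) {y : N} (hy : y ∈ s) :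
      MDifferentiableAt 𝓘(ℝ, F) 𝓘(ℝ, ℝ) g y :=
    (hg.contMDiffAt (hs.mem_nhds hy)).mdifferentiableAt (by simp)
  -- Iterated Leibniz rule for [A, [B, fZ]]. The two middle terms together are symmetric in A and B
  -- and will cancel.
  have key {A : ∀ x : N, TangentSpace 𝓘(ℝ, F) x} {B : ∀ x : N, TangentSpace 𝓘(ℝ, F) x}
    (hA : ContMDiff 𝓘(ℝ, F) 𝓘(ℝ, F).tangent ∞ (fun x => (⟨x, A x⟩ : TangentBundle 𝓘(ℝ, F) N)))
    (hB : ContMDiff 𝓘(ℝ, F) 𝓘(ℝ, F).tangent ∞ (fun x => (⟨x, B x⟩ : TangentBundle 𝓘(ℝ, F) N))) :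
      mlieBracket 𝓘(ℝ, F) A (mlieBracket 𝓘(ℝ, F) B (f • Z)) x
        = mvfderiv 𝓘(ℝ, F) (fun y => mvfderiv 𝓘(ℝ, F) f y (B y)) x (A x) • Z x
          + mvfderiv 𝓘(ℝ, F) f x (B x) • mlieBracket 𝓘(ℝ, F) A Z x
          + mvfderiv 𝓘(ℝ, F) f x (A x) • mlieBracket 𝓘(ℝ, F) B Z x
          + f x • mlieBracket 𝓘(ℝ, F) A (mlieBracket 𝓘(ℝ, F) B Z) x := by
    have h1 : mlieBracket 𝓘(ℝ, F) B (f • Z) =ᶠ[𝓝 x]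
        (fun y => mvfderiv 𝓘(ℝ, F) f y (B y)) • Z + f • mlieBracket 𝓘(ℝ, F) B Z := by
      filter_upwards [hs.mem_nhds hx] with y hy
      exact mlieBracket_smul_right (hfd hf hy) (hmd hZ y)
    have hg := contMDiffOn_mvfderiv_apply hs hf hB
    rw [EventuallyEq.rfl.mlieBracket_vectorField_eq h1, mlieBracket_add_right,
      mlieBracket_smul_right (hfd hg hx) (hmd hZ x),
      mlieBracket_smul_right (hfd hf hx) (hmd (hbr hB hZ) x)]
    · abel
    · exact (hfd hg hx).smul_section (hmd hZ x)
    · exact (hfd hf hx).smul_section (hmd (hbr hB hZ) x)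
  have h2 (A : ∀ x : N, TangentSpace 𝓘(ℝ, F) x)
    (hA : ContMDiffAt 𝓘(ℝ, F) 𝓘(ℝ, F).tangent ∞
      (fun x => (⟨x, A x⟩ : TangentBundle 𝓘(ℝ, F) N)) x) :
      ContMDiffAt 𝓘(ℝ, F) 𝓘(ℝ, F).tangent (minSmoothness ℝ 2)
        (fun x => (⟨x, A x⟩ : TangentBundle 𝓘(ℝ, F) N)) x :=
    hA.of_le (by rw [minSmoothness_of_isRCLikeNormedField]; exact WithTop.coe_le_coe.2 le_top)
  -- The Jacobi identity for X, Y, fZ is compared with f times that for X, Y, Z. What is left is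
  -- ([X, Y]f - XYf + YXf) Z = 0, and Z does not vanish at x.
  have hJ := leibniz_identity_mlieBracket_apply (h2 X (hX x)) (h2 Y (hY x))
    (h2 (f • Z) ((hf.contMDiffAt (hs.mem_nhds hx)).smul_section (hZ x)))
  have hJ' := leibniz_identity_mlieBracket_apply (h2 X (hX x)) (h2 Y (hY x)) (h2 Z (hZ x))
  rw [key hX hY, key hY hX, mlieBracket_smul_right (hfd hf hx) (hmd hZ x), hJ'] at hJ
  have h3 : (mvfderiv 𝓘(ℝ, F) f x (mlieBracket 𝓘(ℝ, F) X Y x)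
      - (mvfderiv 𝓘(ℝ, F) (fun y => mvfderiv 𝓘(ℝ, F) f y (Y y)) x (X x)
        - mvfderiv 𝓘(ℝ, F) (fun y => mvfderiv 𝓘(ℝ, F) f y (X y)) x (Y x))) • Z x = 0 := by
    rw [smul_add] at hJ
    generalize mvfderiv 𝓘(ℝ, F) (fun y => mvfderiv 𝓘(ℝ, F) f y (Y y)) x (X x) = a1 at *
    generalize mvfderiv 𝓘(ℝ, F) (fun y => mvfderiv 𝓘(ℝ, F) f y (X y)) x (Y x) = a2 at *
    generalize mvfderiv 𝓘(ℝ, F) f x (mlieBracket 𝓘(ℝ, F) X Y x) = a3 at *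
    rw [← sub_eq_zero] at hJ
    rw [← neg_eq_zero, ← hJ]
    module
  exact sub_eq_zero.1 ((smul_eq_zero.1 h3).resolve_right hZx)

/-- Continuous functionals separate the points of W and commute with derivatives, which reduces the
claim to real functions. -/
lemma mvfderiv_mlieBracket {W : Type*} [NormedAddCommGroup W] [NormedSpace ℝ W]
    {f : N → W} {s : Set N} (hs : IsOpen s)
    (hf : ContMDiffOn 𝓘(ℝ, F) 𝓘(ℝ, W) ∞ f s) {X Y Z : ∀ x : N, TangentSpace 𝓘(ℝ, F) x}
    (hX : ContMDiff 𝓘(ℝ, F) 𝓘(ℝ, F).tangent ∞ (fun x => (⟨x, X x⟩ : TangentBundle 𝓘(ℝ, F) N)))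
    (hY : ContMDiff 𝓘(ℝ, F) 𝓘(ℝ, F).tangent ∞ (fun x => (⟨x, Y x⟩ : TangentBundle 𝓘(ℝ, F) N)))
    (hZ : ContMDiff 𝓘(ℝ, F) 𝓘(ℝ, F).tangent ∞ (fun x => (⟨x, Z x⟩ : TangentBundle 𝓘(ℝ, F) N)))
    {x : N} (hx : x ∈ s) (hZx : Z x ≠ 0) :
    mvfderiv 𝓘(ℝ, F) f x (mlieBracket 𝓘(ℝ, F) X Y x)
      = mvfderiv 𝓘(ℝ, F) (fun y => mvfderiv 𝓘(ℝ, F) f y (Y y)) x (X x)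
        - mvfderiv 𝓘(ℝ, F) (fun y => mvfderiv 𝓘(ℝ, F) f y (X y)) x (Y x) := by
  have hfd {g : N → W} (hg : ContMDiffOn 𝓘(ℝ, F) 𝓘(ℝ, W) ∞ g s) {y : N} (hy : y ∈ s) :
      MDifferentiableAt 𝓘(ℝ, F) 𝓘(ℝ, W) g y :=
    (hg.contMDiffAt (hs.mem_nhds hy)).mdifferentiableAt (by simp)
  refine (SeparatingDual.eq_iff_forall_dual_eq (R := ℝ)).2 fun L => ?_
  have hL : ContMDiffOn 𝓘(ℝ, F) 𝓘(ℝ, ℝ) ∞ (fun y => L (f y)) s :=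
    L.contMDiff.comp_contMDiffOn hf
  have h2 {A B : ∀ x : N, TangentSpace 𝓘(ℝ, F) x}
    (hA : ContMDiff 𝓘(ℝ, F) 𝓘(ℝ, F).tangent ∞ (fun x => (⟨x, A x⟩ : TangentBundle 𝓘(ℝ, F) N))) :
      mvfderiv 𝓘(ℝ, F) (fun y => mvfderiv 𝓘(ℝ, F) (fun y => L (f y)) y (A y)) x (B x)
        = L (mvfderiv 𝓘(ℝ, F) (fun y => mvfderiv 𝓘(ℝ, F) f y (A y)) x (B x)) := by
    rw [← mvfderiv_clm_comp L (hfd (contMDiffOn_mvfderiv_apply hs hf hA) hx)]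
    have : (fun y => mvfderiv 𝓘(ℝ, F) (fun y => L (f y)) y (A y)) =ᶠ[𝓝 x]
        fun y => L (mvfderiv 𝓘(ℝ, F) f y (A y)) := by
      filter_upwards [hs.mem_nhds hx] with y hy
      exact mvfderiv_clm_comp L (hfd hf hy) _
    have e := this.mfderiv_eq (I := 𝓘(ℝ, F)) (I' := 𝓘(ℝ, ℝ))
    exact DFunLike.congr_fun e (B x)
  have := mvfderiv_mlieBracket_real hs hL hX hY hZ hx hZx
  rw [mvfderiv_clm_comp L (hfd hf hx), h2 hY, h2 hX] at this
  rw [map_sub, this]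

end Derivations

/-! ### Mixed partial derivatives on a product of manifolds, read in charts. -/

section MixedPartials

open Filter Topology

variable {E W : Type*} [NormedAddCommGroup E] [NormedSpace ℝ E] [NormedAddCommGroup W]
  [NormedSpace ℝ W]

lemma fderiv_partial_eventuallyEq {k : E × E → W} {p q : E} (hk : ContDiffAt ℝ ∞ k (p, q)) :
    (fun y => fderiv ℝ (fun z => k (y, z)) q) =ᶠ[𝓝 p]
      fun y => (fderiv ℝ k (y, q)).comp (ContinuousLinearMap.inr ℝ E E) := by
  have h1 : ∀ᶠ w in 𝓝 (p, q), DifferentiableAt ℝ k w :=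
    ((hk.of_le (m := 1) (by simp)).eventually (by simp)).mono
      fun w hw => hw.differentiableAt (by simp)
  have h2 : Tendsto (fun y => (y, q)) (𝓝 p) (𝓝 (p, q)) :=
    (Continuous.prodMk_left q).tendsto p
  filter_upwards [h2.eventually h1] with y hy
  exact (hy.hasFDerivAt.comp q (hasFDerivAt_prodMk_right y q)).fderiv

lemma fderiv_partial_eventuallyEq' {k : E × E → W} {p q : E} (hk : ContDiffAt ℝ ∞ k (p, q)) :
    (fun z => fderiv ℝ (fun y => k (y, z)) p) =ᶠ[𝓝 q]
      fun z => (fderiv ℝ k (p, z)).comp (ContinuousLinearMap.inl ℝ E E) := by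
  have h1 : ∀ᶠ w in 𝓝 (p, q), DifferentiableAt ℝ k w :=
    ((hk.of_le (m := 1) (by simp)).eventually (by simp)).mono
      fun w hw => hw.differentiableAt (by simp)
  have h2 : Tendsto (fun z => (p, z)) (𝓝 q) (𝓝 (p, q)) :=
    (Continuous.prodMk_right p).tendsto q
  filter_upwards [h2.eventually h1] with z hz
  exact (hz.hasFDerivAt.comp p (hasFDerivAt_prodMk_left p z)).fderiv

lemma contDiffAt_fderiv_partial {k : E × E → W} {p q : E} (hk : ContDiffAt ℝ ∞ k (p, q)) :
    ContDiffAt ℝ ∞ (fun y => fderiv ℝ (fun z => k (y, z)) q) p := by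
  refine ContDiffAt.congr_of_eventuallyEq ?_ (fderiv_partial_eventuallyEq hk)
  have h : ContDiffAt ℝ ∞ (fun y => fderiv ℝ k (y, q)) p :=
    (hk.fderiv_right (m := ∞) (by simp)).comp (x := p) (f := fun y => (y, q))
      (contDiffAt_id.prodMk contDiffAt_const)
  exact h.clm_comp contDiffAt_const

/-- Both sides are the second derivative of k, evaluated on (a, 0) and (0, b) in the two orders. -/
lemma fderiv_partial_symm {k : E × E → W} {p q : E} (hk : ContDiffAt ℝ ∞ k (p, q)) (a b : E) :
    fderiv ℝ (fun y => fderiv ℝ (fun z => k (y, z)) q b) p a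
      = fderiv ℝ (fun z => fderiv ℝ (fun y => k (y, z)) p a) q b := by
  have hd : DifferentiableAt ℝ (fderiv ℝ k) (p, q) :=
    (hk.fderiv_right (m := ∞) (by simp)).differentiableAt (by simp)
  have h1 : fderiv ℝ (fun y => fderiv ℝ (fun z => k (y, z)) q b) p a
      = fderiv ℝ (fderiv ℝ k) (p, q) (a, 0) (0, b) := by
    have e : (fun y => fderiv ℝ (fun z => k (y, z)) q b) =ᶠ[𝓝 p]
        fun y => fderiv ℝ k (y, q) (0, b) := by
      filter_upwards [fderiv_partial_eventuallyEq hk] with y hy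
      rw [hy]; simp
    rw [e.fderiv_eq]
    have h0 : HasFDerivAt (fun y => fderiv ℝ k (y, q)) _ p :=
      hd.hasFDerivAt.comp p (f := fun y => (y, q)) (hasFDerivAt_prodMk_left p q)
    rw [(h0.clm_apply (hasFDerivAt_const ((0, b) : E × E) p)).fderiv]
    simp
  have h2 : fderiv ℝ (fun z => fderiv ℝ (fun y => k (y, z)) p a) q b
      = fderiv ℝ (fderiv ℝ k) (p, q) (0, b) (a, 0) := by
    have e : (fun z => fderiv ℝ (fun y => k (y, z)) p a) =ᶠ[𝓝 q]
        fun z => fderiv ℝ k (p, z) (a, 0) := by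
      filter_upwards [fderiv_partial_eventuallyEq' hk] with y hy
      rw [hy]; simp
    rw [e.fderiv_eq]
    have h0 : HasFDerivAt (fun z => fderiv ℝ k (p, z)) _ q :=
      hd.hasFDerivAt.comp q (f := fun z => (p, z)) (hasFDerivAt_prodMk_right p q)
    rw [(h0.clm_apply (hasFDerivAt_const ((a, 0) : E × E) q)).fderiv]
    simp
  rw [h1, h2]
  exact hk.isSymmSndFDerivAt (by rw [minSmoothness_of_isRCLikeNormedField]; exact WithTop.coe_le_coe.2 le_top) _ _

variable {N : Type*} [TopologicalSpace N] [ChartedSpace E N]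

lemma mvfderiv_eq_fderiv_chart {f : N → W} {o : N} (hf : MDifferentiableAt 𝓘(ℝ, E) 𝓘(ℝ, W) f o) :
    mvfderiv 𝓘(ℝ, E) f o
      = fderiv ℝ (fun y => f ((chartAt E o).symm y)) (chartAt E o o) := by
  rw [hf.mvfderiv]
  simp only [writtenInExtChartAt, Function.comp_def, modelWithCornersSelf_coe, Set.range_id,
    fderivWithin_univ]
  rfl

lemma differentiableAt_chart_symm {f : N → W} {o : N}
    (hf : MDifferentiableAt 𝓘(ℝ, E) 𝓘(ℝ, W) f o) :
    DifferentiableAt ℝ (fun y => f ((chartAt E o).symm y)) (chartAt E o o) := by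
  have := hf.2
  simp only [Function.comp_def, modelWithCornersSelf_coe, Set.range_id,
    DifferentiableWithinAtProp, Set.univ_inter, Set.preimage_univ,
    differentiableWithinAt_univ] at this
  exact this

variable [IsManifold 𝓘(ℝ, E) ∞ N]

lemma contDiffAt_chart_symm {h : N × N → W} {o : N}
    (hh : ContMDiffAt (𝓘(ℝ, E).prod 𝓘(ℝ, E)) 𝓘(ℝ, W) ∞ h (o, o)) :
    ContDiffAt ℝ ∞ (fun w : E × E => h ((chartAt E o).symm w.1, (chartAt E o).symm w.2))
      (chartAt E o o, chartAt E o o) := by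
  have hs : ContMDiffAt 𝓘(ℝ, E) 𝓘(ℝ, E) ∞ (chartAt E o).symm (chartAt E o o) :=
    (contMDiffOn_chart_symm (I := 𝓘(ℝ, E)) (n := ∞) (x := o)).contMDiffAt
      ((chartAt E o).open_target.mem_nhds (mem_chart_target E o))
  have h2 : ContMDiffAt 𝓘(ℝ, E × E) (𝓘(ℝ, E).prod 𝓘(ℝ, E)) ∞
      (fun w : E × E => ((chartAt E o).symm w.1, (chartAt E o).symm w.2))
      (chartAt E o o, chartAt E o o) := by
    refine ContMDiffAt.prodMk ?_ ?_
    · exact hs.comp (chartAt E o o, chartAt E o o) contDiff_fst.contMDiff.contMDiffAt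
    · exact hs.comp (chartAt E o o, chartAt E o o) contDiff_snd.contMDiff.contMDiffAt
  refine contMDiffAt_iff_contDiffAt.1 (ContMDiffAt.comp _ ?_ h2)
  simpa using hh

lemma eventually_mdifferentiableAt_partial {h : N × N → W} {o : N}
    (hh : ContMDiffAt (𝓘(ℝ, E).prod 𝓘(ℝ, E)) 𝓘(ℝ, W) ∞ h (o, o)) :
    ∀ᶠ g in 𝓝 o, MDifferentiableAt 𝓘(ℝ, E) 𝓘(ℝ, W) (fun x => h (g, x)) o := by
  have h1 : ∀ᶠ w in 𝓝 (o, o), ContMDiffAt (𝓘(ℝ, E).prod 𝓘(ℝ, E)) 𝓘(ℝ, W) 1 h w :=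
    (contMDiffAt_iff_contMDiffAt_nhds (by simp)).1 (hh.of_le (n := ∞) (m := 1) (by simp))
  have h2 : Tendsto (fun y => (y, o)) (𝓝 o) (𝓝 (o, o)) := (Continuous.prodMk_left o).tendsto o
  filter_upwards [h2.eventually h1] with g hg
  exact (hg.comp o (f := fun x => (g, x)) (contMDiffAt_const.prodMk contMDiffAt_id)).mdifferentiableAt
    (by simp)

/-- The partial derivative of `h` in the second variable at `(g, o)`. -/
noncomputable def partialSnd (h : N × N → W) (o g : N) : E →L[ℝ] W :=
  mvfderiv 𝓘(ℝ, E) (fun x => h (g, x)) o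

/-- The partial derivative in the second variable depends smoothly on the first variable. -/
lemma contMDiffAt_partialSnd {h : N × N → W} {o : N}
    (hh : ContMDiffAt (𝓘(ℝ, E).prod 𝓘(ℝ, E)) 𝓘(ℝ, W) ∞ h (o, o)) :
    ContMDiffAt 𝓘(ℝ, E) 𝓘(ℝ, E →L[ℝ] W) ∞
      (partialSnd (E := E) h o) o := by
  have h1 := contDiffAt_fderiv_partial (contDiffAt_chart_symm hh)
  have hc : ContMDiffAt 𝓘(ℝ, E) 𝓘(ℝ, E) ∞ (chartAt E o) o :=
    (contMDiffOn_chart (I := 𝓘(ℝ, E)) (n := ∞) (x := o)).contMDiffAt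
      ((chartAt E o).open_source.mem_nhds (mem_chart_source E o))
  refine (h1.contMDiffAt.comp o hc).congr_of_eventuallyEq ?_
  filter_upwards [eventually_mdifferentiableAt_partial hh,
    (chartAt E o).open_source.mem_nhds (mem_chart_source E o)] with g hg hgs
  rw [partialSnd, mvfderiv_eq_fderiv_chart hg, Function.comp_apply,
    (chartAt E o).left_inv hgs]

/-- Symmetry of mixed partial derivatives at a point of the diagonal. -/
lemma mvfderiv_partial_symm {h : N × N → W} {o : N}
    (hh : ContMDiffAt (𝓘(ℝ, E).prod 𝓘(ℝ, E)) 𝓘(ℝ, W) ∞ h (o, o)) (a b : E) :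
    mvfderiv 𝓘(ℝ, E) (fun g => mvfderiv 𝓘(ℝ, E) (fun x => h (g, x)) o b) o a
      = mvfderiv 𝓘(ℝ, E) (fun x => mvfderiv 𝓘(ℝ, E) (fun g => h (g, x)) o a) o b := by
  have key {h : N × N → W} (hh : ContMDiffAt (𝓘(ℝ, E).prod 𝓘(ℝ, E)) 𝓘(ℝ, W) ∞ h (o, o)) (a b : E) :
      mvfderiv 𝓘(ℝ, E) (fun g => mvfderiv 𝓘(ℝ, E) (fun x => h (g, x)) o b) o a
      = fderiv ℝ (fun y => fderiv ℝ (fun z => h ((chartAt E o).symm y, (chartAt E o).symm z))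
        (chartAt E o o) b) (chartAt E o o) a := by
    have hs : ContinuousAt (chartAt E o).symm (chartAt E o o) :=
      (chartAt E o).continuousAt_symm (mem_chart_target E o)
    have hs' : Tendsto (chartAt E o).symm (𝓝 (chartAt E o o)) (𝓝 o) := by
      simpa [ContinuousAt] using hs
    have h1 : MDifferentiableAt 𝓘(ℝ, E) 𝓘(ℝ, W)
        (fun g => mvfderiv 𝓘(ℝ, E) (fun x => h (g, x)) o b) o :=
      (((ContinuousLinearMap.apply ℝ W b).contMDiff.contMDiffAt).comp o
        (contMDiffAt_partialSnd hh)).mdifferentiableAt (n := ∞) (by simp)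
    rw [mvfderiv_eq_fderiv_chart h1]
    congr 1
    refine EventuallyEq.fderiv_eq ?_
    filter_upwards [hs'.eventually (eventually_mdifferentiableAt_partial hh)] with y hy
    rw [mvfderiv_eq_fderiv_chart hy]
    rfl
  have hh' : ContMDiffAt (𝓘(ℝ, E).prod 𝓘(ℝ, E)) 𝓘(ℝ, W) ∞ (fun w : N × N => h (w.2, w.1)) (o, o) :=
    ContMDiffAt.comp (o, o) (f := fun w : N × N => (w.2, w.1)) hh
      (contMDiffAt_snd.prodMk contMDiffAt_fst)
  rw [key hh, key hh' b a]
  exact fderiv_partial_symm (contDiffAt_chart_symm hh) a b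

end MixedPartials

/-! ### The derivative of Ad at the identity is the Lie bracket. -/

section AdjointDerivative

open Filter Topology VectorField

variable {E : Type*} [NormedAddCommGroup E] [NormedSpace ℝ E]

lemma mvfderiv_clm_apply {N : Type*} [TopologicalSpace N] [ChartedSpace E N]
    {W W' : Type*} [NormedAddCommGroup W] [NormedSpace ℝ W] [NormedAddCommGroup W']
    [NormedSpace ℝ W'] {T : N → W →L[ℝ] W'} {a : N → W} {x : N}
    (hT : MDifferentiableAt 𝓘(ℝ, E) 𝓘(ℝ, W →L[ℝ] W') T x)
    (ha : MDifferentiableAt 𝓘(ℝ, E) 𝓘(ℝ, W) a x) (v : E) :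
    mvfderiv 𝓘(ℝ, E) (fun y => T y (a y)) x v
      = mvfderiv 𝓘(ℝ, E) (fun y => T y (a x)) x v + T x (mvfderiv 𝓘(ℝ, E) a x v) := by
  have hTa : MDifferentiableAt 𝓘(ℝ, E) 𝓘(ℝ, W') (fun y => T y (a y)) x := hT.clm_apply ha
  have hTx : MDifferentiableAt 𝓘(ℝ, E) 𝓘(ℝ, W') (fun y => T y (a x)) x :=
    hT.clm_apply mdifferentiableAt_const
  have h := (differentiableAt_chart_symm hT).hasFDerivAt.clm_apply
    (differentiableAt_chart_symm ha).hasFDerivAt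
  have h' := (differentiableAt_chart_symm hT).hasFDerivAt.clm_apply
    (hasFDerivAt_const (a x) (chartAt E x x))
  rw [mvfderiv_eq_fderiv_chart hTa, mvfderiv_eq_fderiv_chart hTx, mvfderiv_eq_fderiv_chart ha]
  rw [h.fderiv, h'.fderiv]
  simp [add_comm]
  rfl

/-- Tangent vectors at o are coordinatised by the preferred chart at o itself. Hence composing with
this chart turns T₁G-valued quantities into E-valued ones without changing them. -/
lemma mvfderiv_chartAt_self {N : Type*} [TopologicalSpace N] [ChartedSpace E N]
    [IsManifold 𝓘(ℝ, E) ∞ N] (o : N) (v : E) :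
    mvfderiv 𝓘(ℝ, E) (chartAt E o) o v = v := by
  have hc : ContMDiffAt 𝓘(ℝ, E) 𝓘(ℝ, E) ∞ (chartAt E o) o :=
    (contMDiffOn_chart (I := 𝓘(ℝ, E)) (n := ∞) (x := o)).contMDiffAt
      ((chartAt E o).open_source.mem_nhds (mem_chart_source E o))
  rw [mvfderiv_eq_fderiv_chart (hc.mdifferentiableAt (by simp))]
  have : (fun y => chartAt E o ((chartAt E o).symm y)) =ᶠ[𝓝 (chartAt E o o)] id := by
    filter_upwards [(chartAt E o).open_target.mem_nhds (mem_chart_target E o)] with y hy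
    exact (chartAt E o).right_inv hy
  rw [this.fderiv_eq, fderiv_id]
  rfl

variable {G : Type*} [TopologicalSpace G] [ChartedSpace E G] [Group G]

/-- `g ↦ Ad(g) X` as a map to the model space. -/
noncomputable def AdModel (X : E) (g : G) : E := (Ad g : LieAlg E G →L[ℝ] LieAlg E G) X

lemma mulInvariantVectorField_one (X : LieAlg E G) :
    mulInvariantVectorField X (1 : G) = X := by
  have : (fun x : G => 1 * x) = id := by ext; simp
  rw [mulInvariantVectorField, this, mfderiv_id]
  rfl

variable [LieGroup 𝓘(ℝ, E) ∞ G]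

lemma contMDiffAt_chartAt_one : ContMDiffAt 𝓘(ℝ, E) 𝓘(ℝ, E) ∞ (chartAt E (1 : G)) 1 :=
  (contMDiffOn_chart (I := 𝓘(ℝ, E)) (n := ∞) (x := (1 : G))).contMDiffAt
    ((chartAt E (1 : G)).open_source.mem_nhds (mem_chart_source E (1 : G)))

lemma contMDiffAt_chart_conj : ContMDiffAt (𝓘(ℝ, E).prod 𝓘(ℝ, E)) 𝓘(ℝ, E) ∞
    (fun w : G × G => chartAt E (1 : G) (w.1 * w.2 * w.1⁻¹)) (1, 1) := by
  have h : ContMDiff (𝓘(ℝ, E).prod 𝓘(ℝ, E)) 𝓘(ℝ, E) ∞ (fun w : G × G => w.1 * w.2 * w.1⁻¹) :=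
    (contMDiff_fst.mul contMDiff_snd).mul contMDiff_fst.inv
  refine ContMDiffAt.comp (1, 1) ?_ h.contMDiffAt
  simpa using contMDiffAt_chartAt_one

lemma contMDiffAt_chart_mul : ContMDiffAt (𝓘(ℝ, E).prod 𝓘(ℝ, E)) 𝓘(ℝ, E) ∞
    (fun w : G × G => chartAt E (1 : G) (w.1 * w.2)) (1, 1) := by
  have h : ContMDiff (𝓘(ℝ, E).prod 𝓘(ℝ, E)) 𝓘(ℝ, E) ∞ (fun w : G × G => w.1 * w.2) :=
    contMDiff_fst.mul contMDiff_snd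
  refine ContMDiffAt.comp (1, 1) ?_ h.contMDiffAt
  simpa using contMDiffAt_chartAt_one

lemma contMDiffAt_chart_mul' : ContMDiffAt (𝓘(ℝ, E).prod 𝓘(ℝ, E)) 𝓘(ℝ, E) ∞
    (fun w : G × G => chartAt E (1 : G) (w.2 * w.1)) (1, 1) := by
  have h : ContMDiff (𝓘(ℝ, E).prod 𝓘(ℝ, E)) 𝓘(ℝ, E) ∞ (fun w : G × G => w.2 * w.1) :=
    contMDiff_snd.mul contMDiff_fst
  refine ContMDiffAt.comp (1, 1) ?_ h.contMDiffAt
  simpa using contMDiffAt_chartAt_one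

variable [FiniteDimensional ℝ E]

lemma mdifferentiable_conj (g : G) :
    MDifferentiable 𝓘(ℝ, E) 𝓘(ℝ, E) (fun x : G => g * x * g⁻¹) :=
  (mdifferentiable_mul_right g⁻¹).comp (mdifferentiable_mul_left g)

/-- Exhibits Ad as a partial derivative of a map smooth in both variables, from which smoothness in
g follows. -/
lemma Ad_eq_partialSnd (g : G) (X : E) :
    AdModel X g = partialSnd (fun w : G × G => chartAt E (1 : G) (w.1 * w.2 * w.1⁻¹)) 1 g X := by
  have h := mfderiv_comp_of_eq' (E₁ := E) (E₂ := E) (E₃ := E) (f := chartAt E (1 : G))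
    (g := fun x : G => g * x * g⁻¹) (x := 1) (y := 1)
    (k := fun x : G => chartAt E (1 : G) (g * x * g⁻¹)) (by simp) (fun _ => rfl)
    (contMDiffAt_chartAt_one.mdifferentiableAt (by simp)) (mdifferentiable_conj g 1) X
  exact (mvfderiv_chartAt_self (E := E) (1 : G) _).symm.trans h

lemma contMDiffAt_Ad (X : E) :
    ContMDiffAt 𝓘(ℝ, E) 𝓘(ℝ, E) ∞ (AdModel (E := E) (G := G) X) 1 := by
  rw [show AdModel (E := E) (G := G) X = fun g => _ from funext fun g => Ad_eq_partialSnd g X]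
  exact ((ContinuousLinearMap.apply ℝ E X).contMDiff.contMDiffAt).comp (1 : G)
    (contMDiffAt_partialSnd contMDiffAt_chart_conj)

/-- The derivative of the adjoint action at `1` is the Lie bracket. -/
theorem mvfderiv_Ad (A X : LieAlg E G) :
    mvfderiv 𝓘(ℝ, E) (AdModel (E := E) (G := G) X) 1 A = (show E from (⁅A, X⁆ : LieAlg E G)) := by
  let χ := chartAt E (1 : G)
  -- S g and T g are the derivatives at 1 of left and right translation by g, read in the chart χ.
  let S : G → E →L[ℝ] E := partialSnd (fun w : G × G => χ (w.1 * w.2)) 1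
  let T : G → E →L[ℝ] E := partialSnd (fun w : G × G => χ (w.2 * w.1)) 1
  have hsym (a b : E) : mvfderiv 𝓘(ℝ, E) (fun g => S g b) 1 a
      = mvfderiv 𝓘(ℝ, E) (fun g => T g a) 1 b :=
    mvfderiv_partial_symm (E := E) contMDiffAt_chart_mul a b
  have hT : MDifferentiableAt 𝓘(ℝ, E) 𝓘(ℝ, E →L[ℝ] E) T 1 :=
    (contMDiffAt_partialSnd contMDiffAt_chart_mul').mdifferentiableAt (n := ∞) (by simp)
  have hAd : MDifferentiableAt 𝓘(ℝ, E) 𝓘(ℝ, E) (AdModel (E := E) (G := G) X) 1 :=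
    (contMDiffAt_Ad (E := E) X).mdifferentiableAt (n := ∞) (by simp)
  have hT1 (v : E) : T 1 v = v := by
    have : T 1 = mvfderiv 𝓘(ℝ, E) χ 1 := by simp [T, partialSnd]; rfl
    rw [this]
    exact mvfderiv_chartAt_self (1 : G) v
  have hAd1 : AdModel (E := E) X (1 : G) = X := by
    have : (fun x : G => 1 * x * 1⁻¹) = id := by ext; simp
    unfold AdModel Ad
    rw [this, mfderiv_id]
    rfl
  -- This is g x = (g x g⁻¹) g, differentiated in x at 1.
  have hST : (fun g => S g X) =ᶠ[𝓝 1] fun g => T g (AdModel (E := E) X g) := by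
    filter_upwards [eventually_mdifferentiableAt_partial (E := E) (W := E)
      (contMDiffAt_chart_mul' (G := G))] with g hg
    exact (mfderiv_comp_of_eq' (E₁ := E) (E₂ := E) (E₃ := E) (f := fun x => χ (x * g))
      (g := fun x : G => g * x * g⁻¹) (x := 1) (y := 1)
      (k := fun x : G => χ (g * x)) (by simp) (fun x => by simp) hg
      (mdifferentiable_conj g 1) X).symm
  have h1 : mvfderiv 𝓘(ℝ, E) (fun g => S g X) 1 A
      = mvfderiv 𝓘(ℝ, E) (fun g => T g X) 1 A
        + mvfderiv 𝓘(ℝ, E) (AdModel (E := E) (G := G) X) 1 A := by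
    have e := hST.mfderiv_eq (I := 𝓘(ℝ, E)) (I' := 𝓘(ℝ, E))
    refine (DFunLike.congr_fun e A).trans ?_
    refine (mvfderiv_clm_apply hT hAd A).trans ?_
    rw [hAd1, hT1]
  -- For A ≠ 0 the left invariant field of A serves as the nonvanishing field in
  -- `mvfderiv_mlieBracket`.
  by_cases hA : A = 0
  · subst hA
    rw [zero_lie, map_zero]
    rfl
  have hfield (X : LieAlg E G) : ContMDiff 𝓘(ℝ, E) 𝓘(ℝ, E).tangent ∞
      (fun g : G => (⟨g, mulInvariantVectorField X g⟩ : TangentBundle 𝓘(ℝ, E) G)) :=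
    contMDiff_maurerCartan_symm X
  have hS (Y : LieAlg E G) : (fun g => mvfderiv 𝓘(ℝ, E) χ g (mulInvariantVectorField Y g))
      =ᶠ[𝓝 1] fun g => S g Y := by
    filter_upwards [χ.open_source.mem_nhds (mem_chart_source E (1 : G))] with g hg
    have hc : ContMDiffAt 𝓘(ℝ, E) 𝓘(ℝ, E) ∞ χ g :=
      (contMDiffOn_chart (I := 𝓘(ℝ, E)) (n := ∞) (x := (1 : G))).contMDiffAt
        (χ.open_source.mem_nhds hg)
    exact mfderiv_comp_of_eq' (E₁ := E) (E₂ := E) (E₃ := E) (f := χ)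
      (g := fun x : G => g * x) (x := 1) (y := g) (k := fun x : G => χ (g * x)) (by simp)
      (fun x => rfl) (hc.mdifferentiableAt (by simp)) (mdifferentiable_mul_left g 1) Y
  have h2 := mvfderiv_mlieBracket χ.open_source
    (contMDiffOn_chart (I := 𝓘(ℝ, E)) (n := ∞) (x := (1 : G))) (hfield A) (hfield X) (hfield A)
    (mem_chart_source E (1 : G)) (by rwa [mulInvariantVectorField_one])
  rw [mulInvariantVectorField_one, mulInvariantVectorField_one] at h2
  have e1 := DFunLike.congr_fun ((hS X).mfderiv_eq (I := 𝓘(ℝ, E)) (I' := 𝓘(ℝ, E))) A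
  have e2 := DFunLike.congr_fun ((hS A).mfderiv_eq (I := 𝓘(ℝ, E)) (I' := 𝓘(ℝ, E))) X
  have h3 : (show E from (⁅A, X⁆ : LieAlg E G)) = mvfderiv 𝓘(ℝ, E) (fun g => S g X) 1 A
      - mvfderiv 𝓘(ℝ, E) (fun g => S g A) 1 X := by
    refine (mvfderiv_chartAt_self (E := E) (1 : G) _).symm.trans (h2.trans ?_)
    exact congrArg₂ (fun a b : E => a - b) e1 e2
  -- By symmetry of mixed partials the derivative of S · A along X is that of T · X along A, so `h1`
  -- leaves exactly the derivative of Ad.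
  rw [h3, hsym X A]
  exact (sub_eq_iff_eq_add'.2 h1).symm

end AdjointDerivative

/-! ### Locally flat geometries satisfy the structure equation. -/

section Flat

open Filter Topology VectorField

variable {E : Type*} [NormedAddCommGroup E] [NormedSpace ℝ E] [FiniteDimensional ℝ E]
  {G : Type*} [TopologicalSpace G] [ChartedSpace E G] [Group G] [LieGroup 𝓘(ℝ, E) ∞ G]
  {EP : Type*} [NormedAddCommGroup EP] [NormedSpace ℝ EP]
  {P : Type*} [TopologicalSpace P] [ChartedSpace EP P] [Group P] [LieGroup 𝓘(ℝ, EP) ∞ P]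
  {p : ParabolicSubgroup E G EP P}
  {F : Type*} [NormedAddCommGroup F] [NormedSpace ℝ F]
  {𝒢 : Type*} [TopologicalSpace 𝒢] [ChartedSpace F 𝒢] [IsManifold 𝓘(ℝ, F) ∞ 𝒢]

/-- The structure equation of a flat Cartan connection: `X ↦ θ⁻¹(X)` is compatible with
brackets. -/
def CartanGeometry.IsFlat (𝒞 : CartanGeometry p F 𝒢) : Prop :=
  ∀ (u : 𝒢) (X Y : LieAlg E G),
    mlieBracket 𝓘(ℝ, F) (fun y => (𝒞.θ y).symm X) (fun y => (𝒞.θ y).symm Y) u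
      = (𝒞.θ u).symm ⁅X, Y⁆

/-- The isomorphism θ_u identifies F with 𝔤; this supplies the completeness of F needed to compute
with brackets. -/
lemma CartanGeometry.finiteDimensional (𝒞 : CartanGeometry p F 𝒢) (u : 𝒢) :
    FiniteDimensional ℝ F :=
  LinearEquiv.finiteDimensional (V := LieAlg E G) (𝒞.θ u).symm.toLinearEquiv

/-- The constant fields of the Maurer-Cartan form are the left invariant fields, whose brackets
define the bracket of 𝔤. -/
lemma mlieBracket_maurerCartan_symm (X Y : LieAlg E G) (g : G) :
    mlieBracket 𝓘(ℝ, E) (fun y => (maurerCartan y).symm X) (fun y => (maurerCartan y).symm Y) g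
      = (maurerCartan g).symm ⁅X, Y⁆ :=
  (congrFun (mulInvariantVector_mlieBracket X Y) g).symm

variable (p) in
lemma homogeneousModel_isFlat : (homogeneousModel p).IsFlat :=
  fun u X Y => mlieBracket_maurerCartan_symm X Y u

/-- The local isomorphism Φ pulls left invariant fields back to the constant fields of θ, and
pullback is compatible with brackets. -/
lemma CartanGeometry.LocallyFlat.isFlat {𝒞 : CartanGeometry p F 𝒢} (h : 𝒞.LocallyFlat) :
    𝒞.IsFlat := by
  intro u X Y
  have := 𝒞.finiteDimensional u
  have : CompleteSpace F := FiniteDimensional.complete ℝ F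
  have hm : minSmoothness ℝ 2 ≤ (∞ : WithTop ℕ∞) := by
    rw [minSmoothness_of_isRCLikeNormedField]; exact WithTop.coe_le_coe.2 le_top
  have : IsManifold 𝓘(ℝ, F) 2 𝒢 := IsManifold.of_le (n := ∞) (WithTop.coe_le_coe.2 le_top)
  have : IsManifold 𝓘(ℝ, E) 2 G := IsManifold.of_le (n := ∞) (WithTop.coe_le_coe.2 le_top)
  have : IsManifold 𝓘(ℝ, F) (minSmoothness ℝ 2) 𝒢 := IsManifold.of_le (n := ∞) hm
  have : IsManifold 𝓘(ℝ, E) (minSmoothness ℝ 2) G := IsManifold.of_le (n := ∞) hm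
  obtain ⟨U, Φ, hu, hU, -, hΦ, -, -, hθ⟩ := h u
  have hpull (Z : LieAlg E G) (y : 𝒢) (hy : y ∈ U) :
      mpullback 𝓘(ℝ, F) 𝓘(ℝ, E) Φ (fun g => (maurerCartan g).symm Z) y = (𝒞.θ y).symm Z := by
    have h1 : mfderiv 𝓘(ℝ, F) 𝓘(ℝ, E) Φ y
        = ((𝒞.θ y).trans (maurerCartan (Φ y)).symm : _ →L[ℝ] _) := by
      refine ContinuousLinearMap.ext fun ξ => ?_
      apply (maurerCartan (Φ y)).injective
      refine (hθ y hy ξ).trans ?_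
      simp
    rw [mpullback_apply, h1, ContinuousLinearMap.inverse_equiv]
    simp
  have hev (Z : LieAlg E G) : (fun y => (𝒞.θ y).symm Z) =ᶠ[𝓝 u]
      mpullback 𝓘(ℝ, F) 𝓘(ℝ, E) Φ (fun g => (maurerCartan g).symm Z) := by
    filter_upwards [hU.mem_nhds hu] with y hy
    exact (hpull Z y hy).symm
  rw [(hev X).mlieBracket_vectorField_eq (hev Y), ← mpullback_mlieBracket (n := ∞)
    ((contMDiff_maurerCartan_symm X).mdifferentiable (by simp) _)
    ((contMDiff_maurerCartan_symm Y).mdifferentiable (by simp) _)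
    (hΦ.contMDiffAt (hU.mem_nhds hu)) hm, ← hpull _ u hu]
  simp only [mpullback_apply, mlieBracket_maurerCartan_symm]

end Flat

/-! ### Smoothness and iteration of the fundamental derivative; the Ricci identity. -/

section FundamentalDerivative

open Filter Topology VectorField

variable {E : Type*} [NormedAddCommGroup E] [NormedSpace ℝ E] [FiniteDimensional ℝ E]
  {G : Type*} [TopologicalSpace G] [ChartedSpace E G] [Group G] [LieGroup 𝓘(ℝ, E) ∞ G]
  {EP : Type*} [NormedAddCommGroup EP] [NormedSpace ℝ EP]
  {P : Type*} [TopologicalSpace P] [ChartedSpace EP P] [Group P] [LieGroup 𝓘(ℝ, EP) ∞ P]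
  {p : ParabolicSubgroup E G EP P}
  {F : Type*} [NormedAddCommGroup F] [NormedSpace ℝ F]
  {𝒢 : Type*} [TopologicalSpace 𝒢] [ChartedSpace F 𝒢] [IsManifold 𝓘(ℝ, F) ∞ 𝒢]
  (𝒞 : CartanGeometry p F 𝒢)
  {W : Type*} [NormedAddCommGroup W] [NormedSpace ℝ W]

lemma fundamentalDerivative_eq_mvfderiv (f : 𝒢 → W) (u : 𝒢) (X : LieAlg E G) :
    fundamentalDerivative 𝒞 f u X = mvfderiv 𝓘(ℝ, F) f u ((𝒞.θ u).symm X) := rfl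

variable {𝒞}

lemma contMDiff_fundamentalDerivative_apply {f : 𝒢 → W} (hf : ContMDiff 𝓘(ℝ, F) 𝓘(ℝ, W) ∞ f)
    (X : LieAlg E G) :
    ContMDiff 𝓘(ℝ, F) 𝓘(ℝ, W) ∞ (fun u => fundamentalDerivative 𝒞 f u X) :=
  contMDiffOn_univ.1 (contMDiffOn_mvfderiv_apply isOpen_univ hf.contMDiffOn
    (𝒞.contMDiff_θ_symm X))

/-- As 𝔤 is finite dimensional, smoothness may be tested on the elements of a basis. -/
lemma contMDiff_fundamentalDerivative {f : 𝒢 → W} (hf : ContMDiff 𝓘(ℝ, F) 𝓘(ℝ, W) ∞ f) :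
    ContMDiff 𝓘(ℝ, F) 𝓘(ℝ, LieAlg E G →L[ℝ] W) ∞ (fundamentalDerivative 𝒞 f) := by
  let b := Module.finBasis ℝ (LieAlg E G)
  have h : fundamentalDerivative 𝒞 f = fun u => ∑ i,
      ContinuousLinearMap.smulRightL ℝ (LieAlg E G) W (LinearMap.toContinuousLinearMap (b.coord i))
        (fundamentalDerivative 𝒞 f u (b i)) := by
    ext u X
    conv_lhs => rw [← b.sum_repr X, map_sum]
    simp_rw [map_smul]
    simp
  rw [h]
  refine contMDiff_finsetSum fun i _ => ?_
  exact (ContinuousLinearMap.contMDiff _).comp (contMDiff_fundamentalDerivative_apply hf (b i))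

lemma fundamentalDerivative_clm_comp {W' : Type*} [NormedAddCommGroup W'] [NormedSpace ℝ W']
    (L : W →L[ℝ] W') {f : 𝒢 → W} (hf : ContMDiff 𝓘(ℝ, F) 𝓘(ℝ, W) ∞ f) (u : 𝒢) (X : LieAlg E G) :
    fundamentalDerivative 𝒞 (fun y => L (f y)) u X = L (fundamentalDerivative 𝒞 f u X) :=
  mvfderiv_clm_comp L (hf.mdifferentiable (by simp) u) _

/-- Evaluation at Y is continuous and linear, so D² is an iterated derivative along constant vector
fields. -/
lemma fundamentalDerivative_fundamentalDerivative {f : 𝒢 → W}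
    (hf : ContMDiff 𝓘(ℝ, F) 𝓘(ℝ, W) ∞ f) (u : 𝒢) (X Y : LieAlg E G) :
    fundamentalDerivative 𝒞 (fundamentalDerivative 𝒞 f) u X Y
      = fundamentalDerivative 𝒞 (fun y => fundamentalDerivative 𝒞 f y Y) u X :=
  (fundamentalDerivative_clm_comp (ContinuousLinearMap.apply ℝ W Y)
    (contMDiff_fundamentalDerivative hf) u X).symm

/-- The Ricci identity for flat Cartan geometries. -/
lemma fundamentalDerivative_lie (h𝒞 : 𝒞.IsFlat) {f : 𝒢 → W}
    (hf : ContMDiff 𝓘(ℝ, F) 𝓘(ℝ, W) ∞ f) (u : 𝒢) (X Y : LieAlg E G) :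
    fundamentalDerivative 𝒞 f u ⁅X, Y⁆
      = fundamentalDerivative 𝒞 (fun y => fundamentalDerivative 𝒞 f y Y) u X
        - fundamentalDerivative 𝒞 (fun y => fundamentalDerivative 𝒞 f y X) u Y := by
  -- If X ≠ 0, the constant field of X is the nonvanishing field required by `mvfderiv_mlieBracket`.
  by_cases hX : X = 0
  · subst hX
    have : (fun y => fundamentalDerivative 𝒞 f y 0) = fun _ => (0 : W) := by ext; simp
    rw [this, fundamentalDerivative_eq_mvfderiv 𝒞 (fun _ => (0 : W)), mvfderiv_const]
    simp
  have := 𝒞.finiteDimensional u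
  have : CompleteSpace F := FiniteDimensional.complete ℝ F
  have h := mvfderiv_mlieBracket isOpen_univ hf.contMDiffOn (𝒞.contMDiff_θ_symm X)
    (𝒞.contMDiff_θ_symm Y) (𝒞.contMDiff_θ_symm X) (Set.mem_univ u)
    (by simpa using hX)
  rw [h𝒞 u X Y] at h
  exact h

end FundamentalDerivative

/-! ### The bracket part of the exterior derivative. -/

section BracketTerm

variable {𝔤 : Type*} [LieRing 𝔤] [LieAlgebra ℝ 𝔤] {M : Type*} [AddCommGroup M] [Module ℝ M]

lemma map_update_eq_cons {m : ℕ} (ψ : 𝔤 [⋀^Fin (m + 1)]→ₗ[ℝ] M) (w : Fin (m + 1) → 𝔤)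
    (q : Fin (m + 1)) (x : 𝔤) :
    ψ (Function.update w q x) = (-1 : ℝ) ^ (q : ℕ) • ψ (Fin.cons x (q.removeNth w)) := by
  rw [← Fin.insertNth_removeNth, ψ.map_insertNth, Matrix.vecCons]
  rcases Nat.even_or_odd (q : ℕ) with h | h <;> simp [h.neg_one_pow]

/-- The bracket part of the exterior derivative in terms of the coadjoint action. -/
lemma sum_coadjₗ_removeNth {m : ℕ} (ψ : 𝔤 [⋀^Fin (m + 1)]→ₗ[ℝ] M) (X : Fin (m + 2) → 𝔤) :
    ∑ i : Fin (m + 2), (-1 : ℝ) ^ (i : ℕ) •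
        (1 / 2 : ℝ) • coadjₗ 𝔤 M (m + 1) (X i) ψ (i.removeNth X)
      = ∑ i : Fin (m + 1), ∑ j ∈ Finset.Ici i, (-1 : ℝ) ^ (i.castSucc + j.succ : ℕ) •
        ψ (Fin.cons ⁅X i.castSucc, X j.succ⁆ (j.removeNth (i.castSucc.removeNth X))) := by
  have hneg (x : 𝔤) (w : Fin m → 𝔤) : ψ (Fin.cons (-x) w) = -ψ (Fin.cons x w) :=
    congrArg (fun f => f w) (map_neg ψ.curryLeft x)
  simp_rw [coadjₗ_apply, smul_neg, Finset.smul_sum, ← Finset.sum_neg_distrib]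
  -- Each pair of indices occurs twice, once from each member, with equal contributions; this
  -- absorbs the factor 1/2.
  rw [Fin.sum_sum_eq_sum_triangle_add]
  refine Finset.sum_congr rfl fun i _ => Finset.sum_congr rfl fun j hj => ?_
  rw [Finset.mem_Ici] at hj
  have H₁ : i.castSucc.succAbove j = j.succ := by simp [Fin.succAbove_of_le_castSucc, hj]
  have H₃ : j.succ.succAbove i = i.castSucc := by simp [Fin.succAbove_of_castSucc_lt, hj]
  have H₂ : j.predAbove i.castSucc = i := by simp [Fin.predAbove_of_le_castSucc, hj]
  have H₄ : i.removeNth (j.succ.removeNth X) = j.removeNth (i.castSucc.removeNth X) := by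
    rw [Fin.removeNth_removeNth_eq_swap _ j i.castSucc, H₁, H₂]
  rw [map_update_eq_cons, map_update_eq_cons, H₄]
  simp only [Fin.removeNth, H₁, H₃]
  rw [← lie_skew (X j.succ), hneg]
  simp only [Fin.val_castSucc, Fin.val_succ, pow_add, pow_one]
  module

end BracketTerm

/-! ### The Casimir operator of an irreducible representation. -/

section CasimirEigenvalue

variable {𝔤 : Type*} [LieRing 𝔤] [LieAlgebra ℝ 𝔤] [FiniteDimensional ℝ 𝔤]
  [LieAlgebra.IsKilling ℝ 𝔤] {𝕜 : Type*} [RCLike 𝕜] {V : Type*} [AddCommGroup V] [Module 𝕜 V]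
  [Module ℝ V] [IsScalarTower ℝ 𝕜 V]

lemma casimir_apply (ρ : 𝔤 →ₗ[ℝ] Module.End 𝕜 V) (v : V) :
    casimir ρ v = ∑ l, ρ (upperBasis 𝔤 l) (ρ (lowerBasis 𝔤 l) v) := by
  simp [casimir]

/-- The commutator of ρ(X) with the Casimir operator is the action of X on the inverse Killing form,
which is invariant. -/
lemma casimir_comm (ρ : 𝔤 →ₗ[ℝ] Module.End 𝕜 V)
    (hρ : ∀ X Y v, ρ ⁅X, Y⁆ v = ρ X (ρ Y v) - ρ Y (ρ X v)) (X : 𝔤) (v : V) :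
    casimir ρ (ρ X v) = ρ X (casimir ρ v) := by
  have h := sum_dual_lie (LinearMap.mk₂ ℝ (fun x y => ρ x (ρ y v)) (by simp)
    (by simp) (by simp) (by intros; simp [LinearMap.map_smul_of_tower])) X
  simp only [LinearMap.mk₂_apply, hρ, map_sub, Finset.sum_sub_distrib] at h
  rw [casimir_apply, casimir_apply, map_sum]
  rw [neg_sub] at h
  exact (sub_left_injective h).symm

/-- The Casimir operator of an irreducible representation is multiplication by its eigenvalue. -/
lemma casimir_eq_smul {ρ : 𝔤 →ₗ[ℝ] Module.End 𝕜 V}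
    (hρ : ∀ X Y v, ρ ⁅X, Y⁆ v = ρ X (ρ Y v) - ρ Y (ρ X v)) (hirr : IsIrreducible ρ) {c : 𝕜}
    (hc : Module.End.HasEigenvalue (casimir ρ) c) (v : V) : casimir ρ v = c • v := by
  -- The eigenspace of c is 𝔤-invariant and nonzero, hence everything. No Schur lemma over an
  -- algebraically closed field is needed, as c is given to be an eigenvalue.
  have h := hirr.2 (Module.End.eigenspace (casimir ρ) c) fun X w hw => by
    rw [Module.End.mem_eigenspace_iff] at hw ⊢
    rw [casimir_comm ρ hρ, hw, map_smul]
  exact Module.End.mem_eigenspace_iff.1 ((h.resolve_left hc) ▸ Submodule.mem_top)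

end CasimirEigenvalue

/-! ### Forms as alternating maps on 𝔤 with values in smooth functions. -/

section Forms

open Filter Topology

variable {E : Type*} [NormedAddCommGroup E] [NormedSpace ℝ E] [FiniteDimensional ℝ E]
  {G : Type*} [TopologicalSpace G] [ChartedSpace E G] [Group G] [LieGroup 𝓘(ℝ, E) ∞ G]
  {EP : Type*} [NormedAddCommGroup EP] [NormedSpace ℝ EP]
  {P : Type*} [TopologicalSpace P] [ChartedSpace EP P] [Group P] [LieGroup 𝓘(ℝ, EP) ∞ P]
  {p : ParabolicSubgroup E G EP P}
  {F : Type*} [NormedAddCommGroup F] [NormedSpace ℝ F]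
  {𝒢 : Type*} [TopologicalSpace 𝒢] [ChartedSpace F 𝒢] [IsManifold 𝓘(ℝ, F) ∞ 𝒢]
  {𝕜 : Type*} [RCLike 𝕜]
  {V : Type*} [NormedAddCommGroup V] [NormedSpace 𝕜 V] [NormedSpace ℝ V] [IsScalarTower ℝ 𝕜 V]

variable (F 𝒢 V) in
/-- The space of smooth functions. -/
def smoothFun : Submodule ℝ (𝒢 → V) where
  carrier := {f | ContMDiff 𝓘(ℝ, F) 𝓘(ℝ, V) ∞ f}
  add_mem' hf hg := ContMDiff.add hf hg
  zero_mem' := contMDiff_const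
  smul_mem' c _ hf := (c • ContinuousLinearMap.id ℝ V).contMDiff.comp hf

lemma smoothFun.smooth (f : smoothFun F 𝒢 V) : ContMDiff 𝓘(ℝ, F) 𝓘(ℝ, V) ∞ f.1 := f.2

/-- The fundamental derivative as an action of `𝔤` on smooth functions. -/
noncomputable def derivAction (𝒞 : CartanGeometry p F 𝒢) :
    LieAlg E G →ₗ[ℝ] Module.End ℝ (smoothFun F 𝒢 V) :=
  LinearMap.mk₂ ℝ (fun X f => ⟨fun u => fundamentalDerivative 𝒞 f.1 u X,
      contMDiff_fundamentalDerivative_apply (smoothFun.smooth f) X⟩)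
    (fun X Y f => Subtype.ext (funext fun u => map_add _ X Y))
    (fun c X f => Subtype.ext (funext fun u => map_smul _ c X))
    (fun X f g => Subtype.ext (funext fun u =>
      DFunLike.congr_fun (mvfderiv_add ((smoothFun.smooth f).mdifferentiable (by simp) u)
        ((smoothFun.smooth g).mdifferentiable (by simp) u)) ((𝒞.θ u).symm X)))
    (fun c X f => Subtype.ext (funext fun u =>
      fundamentalDerivative_clm_comp (c • ContinuousLinearMap.id ℝ V) (smoothFun.smooth f) u X))

lemma derivAction_apply (𝒞 : CartanGeometry p F 𝒢) (X : LieAlg E G) (f : smoothFun F 𝒢 V)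
    (u : 𝒢) : (derivAction 𝒞 X f).1 u = fundamentalDerivative 𝒞 f.1 u X := rfl

lemma derivAction_lie {𝒞 : CartanGeometry p F 𝒢} (h𝒞 : 𝒞.IsFlat) (X Y : LieAlg E G)
    (f : smoothFun F 𝒢 V) : derivAction 𝒞 ⁅X, Y⁆ f
      = derivAction 𝒞 X (derivAction 𝒞 Y f) - derivAction 𝒞 Y (derivAction 𝒞 X f) :=
  Subtype.ext (funext fun u => fundamentalDerivative_lie h𝒞 (smoothFun.smooth f) u X Y)

variable [FiniteDimensional 𝕜 V]

variable (𝕜) in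
/-- A `𝕜`-linear endomorphism of a finite dimensional space as a continuous real linear map. -/
def realCLM (f : Module.End 𝕜 V) : V →L[ℝ] V where
  toLinearMap := f.restrictScalars ℝ
  cont := f.continuous_of_finiteDimensional

@[simp] lemma realCLM_apply (f : Module.End 𝕜 V) (v : V) : realCLM 𝕜 f v = f v := rfl

variable (F 𝒢) in
/-- The pointwise action of `𝔤` on smooth functions with values in `V`. -/
noncomputable def pointwiseAction (T : TractorModule p 𝕜 V) :
    LieAlg E G →ₗ[ℝ] Module.End ℝ (smoothFun F 𝒢 V) :=
  LinearMap.mk₂ ℝ (fun X f => ⟨fun u => T.ρ X (f.1 u),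
      (realCLM 𝕜 (T.ρ X)).contMDiff.comp (smoothFun.smooth f)⟩)
    (fun X Y f => Subtype.ext (funext fun u => by simp))
    (fun c X f => Subtype.ext (funext fun u => by simp))
    (fun X f g => Subtype.ext (funext fun u => by simp))
    (fun c X f => Subtype.ext (funext fun u => (realCLM 𝕜 (T.ρ X)).map_smul c (f.1 u)))

variable (T : TractorModule p 𝕜 V)

lemma pointwiseAction_apply (X : LieAlg E G) (f : smoothFun F 𝒢 V) (u : 𝒢) :
    (pointwiseAction F 𝒢 T X f).1 u = T.ρ X (f.1 u) := rfl

lemma pointwiseAction_lie (X Y : LieAlg E G) (f : smoothFun F 𝒢 V) :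
    pointwiseAction F 𝒢 T ⁅X, Y⁆ f = pointwiseAction F 𝒢 T X (pointwiseAction F 𝒢 T Y f)
      - pointwiseAction F 𝒢 T Y (pointwiseAction F 𝒢 T X f) :=
  Subtype.ext (funext fun u => T.ρ_lie X Y (f.1 u))

lemma derivAction_pointwiseAction (𝒞 : CartanGeometry p F 𝒢) (X Y : LieAlg E G)
    (f : smoothFun F 𝒢 V) :
    derivAction 𝒞 X (pointwiseAction F 𝒢 T Y f) = pointwiseAction F 𝒢 T Y (derivAction 𝒞 X f) :=
  Subtype.ext (funext fun u =>
    fundamentalDerivative_clm_comp (realCLM 𝕜 (T.ρ Y)) (smoothFun.smooth f) u X)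

/-- `V`-valued alternating maps with smooth coefficients. -/
abbrev SmoothAlt (E G F 𝒢 V : Type*) [NormedAddCommGroup E] [NormedSpace ℝ E]
    [FiniteDimensional ℝ E] [TopologicalSpace G] [ChartedSpace E G] [Group G]
    [LieGroup 𝓘(ℝ, E) ∞ G] [NormedAddCommGroup F] [NormedSpace ℝ F] [TopologicalSpace 𝒢]
    [ChartedSpace F 𝒢] [NormedAddCommGroup V] [NormedSpace ℝ V] (k : ℕ) : Type _ :=
  LieAlg E G [⋀^Fin k]→ₗ[ℝ] smoothFun F 𝒢 V

/-- A form as an alternating map with values in smooth functions. -/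
noncomputable def TractorForm.toAlt {𝒞 : CartanGeometry p F 𝒢} {T : TractorModule p 𝕜 V} {k : ℕ}
    (φ : TractorForm 𝒞 T k) : SmoothAlt E G F 𝒢 V k where
  toFun X := ⟨fun u => φ.toFun u X,
    ((ContinuousAlternatingMap.apply ℝ (LieAlg E G) V X).contMDiff).comp φ.smooth⟩
  map_update_add' X i x y := Subtype.ext (funext fun u => by simp)
  map_update_smul' X i c x := Subtype.ext (funext fun u => by simp)
  map_eq_zero_of_eq' X i j h hij := Subtype.ext (funext fun u =>
    (φ.toFun u).map_eq_zero_of_eq X h hij)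

/-- By flatness the bracket of constant fields is the constant field of the bracket in 𝔤, so no
curvature term appears and d^∇ becomes algebraic. -/
lemma extCovDeriv_eq_chevalley {𝒞 : CartanGeometry p F 𝒢} (h𝒞 : 𝒞.IsFlat) {k : ℕ}
    (ψ : SmoothAlt E G F 𝒢 V k) (u : 𝒢) (X : Fin (k + 1) → LieAlg E G) :
    extCovDeriv 𝒞 T (fun y Y => (ψ Y).1 y) u X
      = (chevalley (derivAction 𝒞 + pointwiseAction F 𝒢 T) ψ X).1 u := by
  have hbr (X Y : LieAlg E G) : fieldBracket 𝒞 u X Y = ⁅X, Y⁆ := by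
    rw [fieldBracket, h𝒞]; simp
  have h1 : chevalley (derivAction 𝒞 + pointwiseAction F 𝒢 T) ψ X
      = ∑ i : Fin (k + 1), (-1 : ℝ) ^ (i : ℕ) •
          (derivAction 𝒞 + pointwiseAction F 𝒢 T :
            LieAlg E G →ₗ[ℝ] Module.End ℝ (smoothFun F 𝒢 V)) (X i) (ψ (i.removeNth X))
        + ∑ i : Fin (k + 1), (-1 : ℝ) ^ (i : ℕ) •
          (1 / 2 : ℝ) • coadjₗ _ _ k (X i) ψ (i.removeNth X) := by
    rw [chevalley, AlternatingMap.alternatizeUncurryFin_apply, ← Finset.sum_add_distrib]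
    refine Finset.sum_congr rfl fun i _ => ?_
    rw [← smul_add]
    rcases Nat.even_or_odd (i : ℕ) with h | h <;> simp [h.neg_one_pow]
  have hev (f g : smoothFun F 𝒢 V) : (f + g).1 u = f.1 u + g.1 u := rfl
  have hev' {ι : Type} (s : Finset ι) (f : ι → smoothFun F 𝒢 V) :
      (∑ i ∈ s, f i).1 u = ∑ i ∈ s, (f i).1 u := by
    simp
  have hsm (c : ℝ) (f : smoothFun F 𝒢 V) : (c • f).1 u = c • f.1 u := rfl
  rw [h1, extCovDeriv, hev, hev']
  congr 1
  cases k with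
  | zero => simp [coadjₗ_zero, bracketTerm]
  | succ m =>
    rw [sum_coadjₗ_removeNth, hev']
    refine Finset.sum_congr rfl fun i _ => ?_
    rw [hev']
    refine Finset.sum_congr rfl fun j _ => ?_
    rw [hbr, hsm]

variable [LieAlgebra.IsKilling ℝ (LieAlg E G)]

lemma codifferential_eq_homologyDiff {k : ℕ} (ψ : SmoothAlt E G F 𝒢 V (k + 1)) (u : 𝒢)
    (Y : Fin k → LieAlg E G) :
    codifferential T.ρ (fun X => (ψ X).1 u) Y
      = (homologyDiff (pointwiseAction F 𝒢 T) ψ Y).1 u := by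
  have hev : homologyDiff (pointwiseAction F 𝒢 T) ψ Y
      = -(∑ l, pointwiseAction F 𝒢 T (upperBasis (LieAlg E G) l)
            (ψ (Fin.cons (lowerBasis (LieAlg E G) l) Y)))
        + (1 / 2 : ℝ) • ∑ l, ∑ j, ψ (Fin.cons (lowerBasis (LieAlg E G) l)
        (Function.update Y j ⁅upperBasis (LieAlg E G) l, Y j⁆)) := by
    have hsum {ι : Type} (s : Finset ι) (g : ι → SmoothAlt E G F 𝒢 V k) :
        (∑ l ∈ s, g l) Y = ∑ l ∈ s, g l Y :=
      map_sum (AddMonoidHom.mk' (fun g : SmoothAlt E G F 𝒢 V k => g Y) fun _ _ => rfl) g s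
    rw [homologyDiff, AlternatingMap.neg_apply, hsum, neg_eq_iff_eq_neg, neg_add, neg_neg,
      Finset.smul_sum, ← sub_eq_add_neg, ← Finset.sum_sub_distrib]
    refine Finset.sum_congr rfl fun l _ => ?_
    simp [coadjₗ_apply, Matrix.vecCons, AlternatingMap.curryLeft_apply_apply, sub_eq_add_neg, Fin.cons_update]
  rw [hev]
  simp [codifferential, pointwiseAction_apply]

end Forms

/-! ### Differentiating P-equivariance. -/

section Equivariance

open Filter Topology

variable {E : Type*} [NormedAddCommGroup E] [NormedSpace ℝ E] [FiniteDimensional ℝ E]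
  {G : Type*} [TopologicalSpace G] [ChartedSpace E G] [Group G] [LieGroup 𝓘(ℝ, E) ∞ G]
  {EP : Type*} [NormedAddCommGroup EP] [NormedSpace ℝ EP]
  {P : Type*} [TopologicalSpace P] [ChartedSpace EP P] [Group P] [LieGroup 𝓘(ℝ, EP) ∞ P]
  {p : ParabolicSubgroup E G EP P}
  {F : Type*} [NormedAddCommGroup F] [NormedSpace ℝ F]
  {𝒢 : Type*} [TopologicalSpace 𝒢] [ChartedSpace F 𝒢] [IsManifold 𝓘(ℝ, F) ∞ 𝒢]
  {𝕜 : Type*} [RCLike 𝕜]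
  {V : Type*} [NormedAddCommGroup V] [NormedSpace 𝕜 V] [NormedSpace ℝ V] [IsScalarTower ℝ 𝕜 V]
  [FiniteDimensional 𝕜 V]

/-- The structure gives smoothness of h ↦ σ(h)v for each v; on a finite dimensional space, expansion
in a basis upgrades this to operator-valued differentiability. -/
lemma mdifferentiable_realCLM_σ (T : TractorModule p 𝕜 V) :
    MDifferentiable 𝓘(ℝ, EP) 𝓘(ℝ, V →L[ℝ] V) (fun h => realCLM 𝕜 (T.σ h)) := by
  have : FiniteDimensional ℝ V := Module.Finite.trans 𝕜 V
  let b := Module.finBasis ℝ V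
  have h : (fun h => realCLM 𝕜 (T.σ h)) = fun h => ∑ i,
      ContinuousLinearMap.smulRightL ℝ V V (LinearMap.toContinuousLinearMap (b.coord i))
        (T.σ h (b i)) := by
    ext h v
    conv_lhs => rw [← b.sum_repr v, map_sum]
    simp_rw [map_smul]
    simp
  rw [h]
  have h' : ContMDiff 𝓘(ℝ, EP) 𝓘(ℝ, V →L[ℝ] V) ∞ fun h => ∑ i,
      ContinuousLinearMap.smulRightL ℝ V V (LinearMap.toContinuousLinearMap (b.coord i))
        (T.σ h (b i)) :=
    contMDiff_finsetSum fun i _ =>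
      (ContinuousLinearMap.contMDiff _).comp (T.contMDiff_σ (b i))
  exact h'.mdifferentiable (by simp)

lemma Ad_one_apply (X : LieAlg E G) : Ad (1 : G) X = X := by
  have : (fun x : G => 1 * x * 1⁻¹) = id := by ext; simp
  unfold Ad
  rw [this, mfderiv_id]
  rfl

variable (E G) in
/-- The identity map from the model space to the Lie algebra. -/
noncomputable def modelToLieAlg : E →L[ℝ] LieAlg E G := ContinuousLinearMap.id ℝ E

variable (p) in
lemma contMDiffAt_Ad_ι (X : LieAlg E G) :
    ContMDiffAt 𝓘(ℝ, EP) 𝓘(ℝ, E) ∞ (fun h => AdModel (E := E) X (p.ι h)) 1 := by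
  refine ContMDiffAt.comp (I' := 𝓘(ℝ, E)) (1 : P) (g := AdModel (E := E) (G := G) X) ?_
    (p.contMDiff_ι 1)
  rw [map_one]
  exact contMDiffAt_Ad (E := E) X

variable (p) in
lemma mfderiv_Ad_ι (X : LieAlg E G) (A : LieAlg EP P) :
    (mfderiv 𝓘(ℝ, EP) 𝓘(ℝ, E) (fun h => AdModel (E := E) X (p.ι h)) 1 : EP →L[ℝ] E) A
      = (show E from (⁅p.dι A, X⁆ : LieAlg E G)) := by
  have h := mfderiv_comp_of_eq' (E₁ := EP) (E₂ := E) (E₃ := E)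
    (f := AdModel (E := E) (G := G) X) (g := p.ι) (x := 1) (y := 1)
    (k := fun h => AdModel (E := E) X (p.ι h)) (map_one _) (fun _ => rfl)
    ((contMDiffAt_Ad (E := E) X).mdifferentiableAt (n := ∞) (by simp))
    (p.contMDiff_ι.mdifferentiable (by simp) 1) A
  rw [← h, ← mvfderiv_Ad, p.dι_eq]
  rfl

variable (p) in
lemma mdifferentiableAt_Ad_pi {k : ℕ} (X : Fin k → LieAlg E G) :
    MDifferentiableAt 𝓘(ℝ, EP) 𝓘(ℝ, Fin k → LieAlg E G)
      (fun (h : P) i => modelToLieAlg E G (AdModel (E := E) (X i) (p.ι h))) 1 :=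
  ContMDiffAt.mdifferentiableAt (n := ∞) (contMDiffAt_pi_space.2 fun i =>
    (modelToLieAlg E G).contMDiff.contMDiffAt.comp
      (I' := 𝓘(ℝ, E)) (1 : P) (contMDiffAt_Ad_ι p (X i))) (by simp)

variable (p) in
lemma mfderiv_Ad_pi {k : ℕ} (X : Fin k → LieAlg E G) (A : LieAlg EP P) :
    (mfderiv 𝓘(ℝ, EP) 𝓘(ℝ, Fin k → LieAlg E G)
      (fun (h : P) i => modelToLieAlg E G (AdModel (E := E) (X i) (p.ι h))) 1 :
        EP →L[ℝ] Fin k → LieAlg E G) A = fun i => ⁅p.dι A, X i⁆ := by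
  funext i
  have h1 := mfderiv_comp_of_eq' (E₁ := EP) (E₂ := Fin k → LieAlg E G) (E₃ := LieAlg E G)
    (f := ContinuousLinearMap.proj (R := ℝ) (φ := fun _ : Fin k => LieAlg E G) i)
    (g := fun (h : P) i => modelToLieAlg E G (AdModel (E := E) (X i) (p.ι h))) (x := 1)
    (k := fun h => modelToLieAlg E G (AdModel (E := E) (X i) (p.ι h))) rfl (fun _ => rfl)
    ((ContinuousLinearMap.contMDiff _).mdifferentiable (n := ∞) (by simp) _)
    (mdifferentiableAt_Ad_pi p X) A
  have h2 := mfderiv_comp_of_eq' (E₁ := EP) (E₂ := E) (E₃ := LieAlg E G)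
    (f := modelToLieAlg E G) (g := fun h => AdModel (E := E) (X i) (p.ι h)) (x := 1)
    (k := fun h => modelToLieAlg E G (AdModel (E := E) (X i) (p.ι h))) rfl (fun _ => rfl)
    ((ContinuousLinearMap.contMDiff _).mdifferentiable (n := ∞) (by simp) _)
    ((contMDiffAt_Ad_ι p (X i)).mdifferentiableAt (by simp)) A
  rw [mfderiv_eq_fderiv, ContinuousLinearMap.fderiv] at h1 h2
  refine h1.trans (h2.symm.trans ?_)
  rw [mfderiv_Ad_ι]
  rfl

variable {𝒞 : CartanGeometry p F 𝒢}

/-- Chain rule along the orbit of u: the velocity at 1 is the fundamental vector field of A, which θ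
maps to `p.dι A`. -/
lemma mfderiv_act {W : Type*} [NormedAddCommGroup W] [NormedSpace ℝ W] {f : 𝒢 → W}
    (hf : MDifferentiable 𝓘(ℝ, F) 𝓘(ℝ, W) f) (u : 𝒢) (A : LieAlg EP P) :
    (mfderiv 𝓘(ℝ, EP) 𝓘(ℝ, W) (fun h => f (𝒞.act u h)) 1 : EP →L[ℝ] W) A
      = fundamentalDerivative 𝒞 f u (p.dι A) := by
  have hact : ContMDiff 𝓘(ℝ, EP) 𝓘(ℝ, F) ∞ (fun h : P => 𝒞.act u h) :=
    𝒞.contMDiff_act.comp (contMDiff_const.prodMk contMDiff_id)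
  have h := mfderiv_comp_of_eq' (E₁ := EP) (E₂ := F) (E₃ := W)
    (f := f) (g := fun h : P => 𝒞.act u h) (x := 1) (k := fun h => f (𝒞.act u h)) rfl
    (fun _ => rfl) (hf _) (hact.mdifferentiable (by simp) 1) A
  refine h.symm.trans ?_
  have h1 : fundamentalDerivative 𝒞 f u (p.dι A)
      = fundamentalDerivative 𝒞 f (𝒞.act u 1) (p.dι A) := by rw [𝒞.act_one]
  rw [h1, ← 𝒞.θ_fundamental u A]
  rw [fundamentalDerivative_eq_mvfderiv]
  exact congrArg (mvfderiv 𝓘(ℝ, F) f (𝒞.act u 1))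
    ((𝒞.θ (𝒞.act u 1)).symm_apply_apply _).symm

/-- The infinitesimal version of the equivariance of forms. -/
lemma TractorForm.fundamentalDerivative_dι {T : TractorModule p 𝕜 V} {k : ℕ}
    (φ : TractorForm 𝒞 T k) (u : 𝒢) (X : Fin k → LieAlg E G) (A : LieAlg EP P) :
    fundamentalDerivative 𝒞 (fun y => φ.toFun y X) u (p.dι A) + T.ρ (p.dι A) (φ.toFun u X)
      = ∑ j, φ.toFun u (Function.update X j ⁅p.dι A, X j⁆) := by
  have hφ : MDifferentiable 𝓘(ℝ, F) 𝓘(ℝ, V) (fun y => φ.toFun y X) :=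
    (((ContinuousAlternatingMap.apply ℝ (LieAlg E G) V X).contMDiff).comp
      φ.smooth).mdifferentiable (by simp)
  have hact : ContMDiff 𝓘(ℝ, EP) 𝓘(ℝ, F) ∞ (fun h : P => 𝒞.act u h) :=
    𝒞.contMDiff_act.comp (contMDiff_const.prodMk contMDiff_id)
  -- Applying σ(h) to the equivariance relation removes the inverse, leaving σ(h) φ(u·h)(X) =
  -- φ(u)(Ad(h)X). Differentiating this at h = 1 gives the claim.
  have heq : (fun h => realCLM 𝕜 (T.σ h) (φ.toFun (𝒞.act u h) X))
      = fun h => φ.toFun u fun i => modelToLieAlg E G (AdModel (E := E) (X i) (p.ι h)) := by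
    funext h
    rw [φ.equivariant, realCLM_apply, ← Module.End.mul_apply, ← map_mul, mul_inv_cancel, map_one]
    rfl
  -- The product rule: the factor σ(h) contributes the ρ-term, the point u·h the fundamental
  -- derivative.
  have h1 := mvfderiv_clm_apply (mdifferentiable_realCLM_σ T 1)
    ((hφ _).comp (1 : P) (hact.mdifferentiable (by simp) 1)) A
  have h2 : mvfderiv 𝓘(ℝ, EP) (fun h => φ.toFun u fun i =>
      modelToLieAlg E G (AdModel (E := E) (X i) (p.ι h))) 1 A
      = ∑ j, φ.toFun u (Function.update X j ⁅p.dι A, X j⁆) := by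
    have hd := (φ.toFun u).toContinuousMultilinearMap.hasFDerivAt X
    have hX : (fun i => modelToLieAlg E G (AdModel (E := E) (X i) (p.ι 1))) = X := by
      funext i
      rw [map_one]
      exact Ad_one_apply (X i)
    refine (mfderiv_comp_of_eq' (E₁ := EP) (E₂ := Fin k → LieAlg E G) (E₃ := V)
      (f := fun w => φ.toFun u w)
      (g := fun (h : P) i => modelToLieAlg E G (AdModel (E := E) (X i) (p.ι h))) (x := 1)
      hX (fun _ => rfl) hd.hasMFDerivAt.mdifferentiableAt (mdifferentiableAt_Ad_pi p X)
      A).symm.trans ?_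
    rw [mfderiv_Ad_pi, mfderiv_eq_fderiv]
    erw [hd.fderiv]
    exact (φ.toFun u).toContinuousMultilinearMap.linearDeriv_apply X fun i => ⁅p.dι A, X i⁆
  simp only [Function.comp_def] at h1
  rw [heq, h2] at h1
  rw [h1, add_comm]
  refine congrArg₂ (· + ·) ?_ ?_
  · rw [𝒞.act_one]
    exact (T.mfderiv_σ A _).symm
  · rw [map_one]
    exact (mfderiv_act hφ u A).symm

end Equivariance

/-! ### Assembling the formula for the curved Casimir operator. -/

section CurvedCasimirFormula

variable {E : Type*} [NormedAddCommGroup E] [NormedSpace ℝ E] [FiniteDimensional ℝ E]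
  {G : Type*} [TopologicalSpace G] [ChartedSpace E G] [Group G] [LieGroup 𝓘(ℝ, E) ∞ G]
  [LieAlgebra.IsSemisimple ℝ (LieAlg E G)]
  {EP : Type*} [NormedAddCommGroup EP] [NormedSpace ℝ EP]
  {P : Type*} [TopologicalSpace P] [ChartedSpace EP P] [Group P] [LieGroup 𝓘(ℝ, EP) ∞ P]
  {p : ParabolicSubgroup E G EP P}
  {F : Type*} [NormedAddCommGroup F] [NormedSpace ℝ F]
  {𝒢 : Type*} [TopologicalSpace 𝒢] [ChartedSpace F 𝒢] [IsManifold 𝓘(ℝ, F) ∞ 𝒢]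
  {𝒞 : CartanGeometry p F 𝒢}
  {𝕜 : Type*} [RCLike 𝕜]
  {V : Type*} [NormedAddCommGroup V] [NormedSpace 𝕜 V] [NormedSpace ℝ V] [IsScalarTower ℝ 𝕜 V]
  {k : ℕ}

lemma dualSum_apply_apply (a b : LieAlg E G →ₗ[ℝ] Module.End ℝ (SmoothAlt E G F 𝒢 V k))
    (ψ : SmoothAlt E G F 𝒢 V k) (X : Fin k → LieAlg E G) (u : 𝒢) :
    (dualSum a b ψ X).1 u
      = ∑ l, (a (upperBasis (LieAlg E G) l) (b (lowerBasis (LieAlg E G) l) ψ) X).1 u := by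
  rw [dualSum_apply]
  exact map_sum (AddMonoidHom.mk' (fun g : SmoothAlt E G F 𝒢 V k => (g X).1 u) fun _ _ => rfl) _ _

variable {T : TractorModule p 𝕜 V}

lemma curvedCasimir_apply (φ : TractorForm 𝒞 T k) (u : 𝒢) (X : Fin k → LieAlg E G) :
    curvedCasimir 𝒞 φ.toFun u X = (dualSum (post (LieAlg E G) k (derivAction 𝒞))
      (post (LieAlg E G) k (derivAction 𝒞)) φ.toAlt X).1 u := by
  rw [dualSum_apply_apply, curvedCasimir, ContinuousAlternatingMap.sum_apply]
  refine Finset.sum_congr rfl fun l _ => ?_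
  rw [fundamentalDerivative_fundamentalDerivative φ.smooth, post_apply, post_apply,
    derivAction_apply]
  refine (fundamentalDerivative_clm_comp (ContinuousAlternatingMap.apply ℝ (LieAlg E G) V X)
    (contMDiff_fundamentalDerivative_apply φ.smooth _) u _).symm.trans ?_
  congr 2
  funext y
  exact (fundamentalDerivative_clm_comp (ContinuousAlternatingMap.apply ℝ (LieAlg E G) V X)
    φ.smooth y _).symm

variable [FiniteDimensional 𝕜 V]

lemma dualSum_pointwiseAction_apply (φ : TractorForm 𝒞 T k) (u : 𝒢) (X : Fin k → LieAlg E G) :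
    (dualSum (post (LieAlg E G) k (pointwiseAction F 𝒢 T))
      (post (LieAlg E G) k (pointwiseAction F 𝒢 T)) φ.toAlt X).1 u
      = casimir T.ρ (φ.toFun u X) := by
  rw [dualSum_apply_apply, casimir_apply]
  rfl

variable (𝒞 T) in
/-- The covariant derivative `X ↦ D_X + X •` as an action of `𝔤` on smooth functions. -/
noncomputable abbrev tractorAction : LieAlg E G →ₗ[ℝ] Module.End ℝ (smoothFun F 𝒢 V) :=
  derivAction 𝒞 + pointwiseAction F 𝒢 T

/-- Flatness of the tractor connection: D and ρ are both representations, and the cross terms cancel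
because they commute. -/
lemma tractorAction_lie (h𝒞 : 𝒞.IsFlat) (X Y : LieAlg E G) (f : smoothFun F 𝒢 V) :
    tractorAction 𝒞 T ⁅X, Y⁆ f = tractorAction 𝒞 T X (tractorAction 𝒞 T Y f)
      - tractorAction 𝒞 T Y (tractorAction 𝒞 T X f) := by
  simp only [tractorAction, LinearMap.add_apply, map_add, derivAction_lie h𝒞, pointwiseAction_lie,
    derivAction_pointwiseAction]
  abel

/-- The infinitesimal equivariance of φ says exactly that the Lie derivative L_a = D_a + ρ(a) +
ad*(a) annihilates it for a ∈ 𝔭. -/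
lemma TractorForm.toAlt_basic (φ : TractorForm 𝒞 T k) {a : LieAlg E G} (ha : a ∈ p.lieAlg) :
    (post (LieAlg E G) k (tractorAction 𝒞 T)
      + coadjₗ (LieAlg E G) (smoothFun F 𝒢 V) k) a φ.toAlt = 0 := by
  obtain ⟨A, rfl⟩ := ha
  refine AlternatingMap.ext fun X => ?_
  refine Subtype.ext (funext fun u => ?_)
  have h := φ.fundamentalDerivative_dι u X A
  rw [← sub_eq_zero, sub_eq_add_neg] at h
  refine Eq.trans ?_ h
  rw [LinearMap.add_apply, LinearMap.add_apply, AlternatingMap.add_apply, coadjₗ_apply]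
  have hsum : (∑ j, φ.toAlt (Function.update X j ⁅p.dι A, X j⁆)).1 u
      = ∑ j, φ.toFun u (Function.update X j ⁅p.dι A, X j⁆) :=
    map_sum (AddMonoidHom.mk' (fun f : smoothFun F 𝒢 V => f.1 u) fun _ _ => rfl) _ _
  rw [← hsum]
  rfl

/-- The curved Casimir operator of a flat parabolic geometry on tractor valued forms. -/
theorem curvedCasimir_eq_of_isFlat (h𝒞 : 𝒞.IsFlat) (hT : IsIrreducible T.ρ) {c₀ : 𝕜}
    (hc₀ : Module.End.HasEigenvalue (casimir T.ρ) c₀) (φ : TractorForm 𝒞 T k) (u : 𝒢)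
    (X : Fin k → LieAlg E G) :
    curvedCasimir 𝒞 φ.toFun u X
      = (2 : ℝ) • boxR 𝒞 T (fun y => φ.toFun y) u X + c₀ • φ.toFun u X := by
  rw [← casimir_eq_smul T.ρ_lie hT hc₀, ← dualSum_pointwiseAction_apply, curvedCasimir_apply,
    ← sub_eq_iff_eq_add]
  -- This removes C(L, L) from the box identity, leaving C(D, D) - C(ρ, ρ) = 2□.
  have h0 := dualSum_eq_zero_of_basic (tractorAction 𝒞 T)
    (tractorAction_lie h𝒞) p.isParabolic φ.toAlt fun a ha => φ.toAlt_basic ha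
  have hd {k : ℕ} (ψ : SmoothAlt E G F 𝒢 V k) : extCovDeriv 𝒞 T (fun y Y => (ψ Y).1 y)
      = fun y Y => (chevalley (tractorAction 𝒞 T) ψ Y).1 y :=
    funext fun y => funext fun Y => extCovDeriv_eq_chevalley T h𝒞 ψ y Y
  have hδ {k : ℕ} (ψ : SmoothAlt E G F 𝒢 V (k + 1)) : codiff T (fun y Y => (ψ Y).1 y)
      = fun y Y => (homologyDiff (pointwiseAction F 𝒢 T) ψ Y).1 y :=
    funext fun y => funext fun Y => codifferential_eq_homologyDiff T ψ y Y
  have hφ : (fun y => ⇑(φ.toFun y)) = fun y Y => (φ.toAlt Y).1 y := rfl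
  cases k with
  | zero =>
    have h := two_smul_box_zero (derivAction 𝒞) (pointwiseAction F 𝒢 T)
      (derivAction_pointwiseAction T 𝒞) φ.toAlt
    rw [h0] at h
    rw [boxR, hφ, hd, hδ]
    exact (sub_zero _).symm.trans (congrArg (fun ψ : SmoothAlt E G F 𝒢 V 0 => (ψ X).1 u) h).symm
  | succ m =>
    have h := two_smul_box (derivAction 𝒞) (pointwiseAction F 𝒢 T) (pointwiseAction_lie T)
      (derivAction_pointwiseAction T 𝒞) φ.toAlt
    rw [h0] at h
    rw [boxR, hφ, hd, hδ, hδ, hd]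
    exact (sub_zero _).symm.trans (congrArg (fun ψ : SmoothAlt E G F 𝒢 V (m + 1) => (ψ X).1 u) h).symm

end CurvedCasimirFormula

end CurvedCasimir

theorem corollary4p3
    {E : Type*} [NormedAddCommGroup E] [NormedSpace ℝ E] [FiniteDimensional ℝ E]
    {G : Type*} [TopologicalSpace G] [ChartedSpace E G] [Group G] [LieGroup 𝓘(ℝ, E) ∞ G]
    [LieAlgebra.IsSemisimple ℝ (CurvedCasimir.LieAlg E G)]
    {EP : Type*} [NormedAddCommGroup EP] [NormedSpace ℝ EP]
    {P : Type*} [TopologicalSpace P] [ChartedSpace EP P] [Group P] [LieGroup 𝓘(ℝ, EP) ∞ P]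
    (p : CurvedCasimir.ParabolicSubgroup E G EP P)
    {𝕜 : Type*} [RCLike 𝕜]
    {V : Type*} [NormedAddCommGroup V] [NormedSpace 𝕜 V] [NormedSpace ℝ V]
    [IsScalarTower ℝ 𝕜 V] [FiniteDimensional 𝕜 V]
    (T : CurvedCasimir.TractorModule p 𝕜 V) (hT : CurvedCasimir.IsIrreducible T.ρ)
    (c₀ : 𝕜) (hc₀ : Module.End.HasEigenvalue (CurvedCasimir.casimir T.ρ) c₀) :
    (∀ (k : ℕ) (φ : CurvedCasimir.TractorForm (CurvedCasimir.homogeneousModel p) T k)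
        (u : G) (X : Fin k → CurvedCasimir.LieAlg E G),
      CurvedCasimir.curvedCasimir (CurvedCasimir.homogeneousModel p) φ.toFun u X =
        (2 : ℝ) • CurvedCasimir.boxR (CurvedCasimir.homogeneousModel p) T
            (fun y => φ.toFun y) u X
          + c₀ • φ.toFun u X) ∧
    (∀ (F : Type*) [NormedAddCommGroup F] [NormedSpace ℝ F]
        (𝒢 : Type*) [TopologicalSpace 𝒢] [ChartedSpace F 𝒢] [IsManifold 𝓘(ℝ, F) ∞ 𝒢]
        (𝒞 : CurvedCasimir.CartanGeometry p F 𝒢), 𝒞.LocallyFlat →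
      ∀ (k : ℕ) (φ : CurvedCasimir.TractorForm 𝒞 T k)
        (u : 𝒢) (X : Fin k → CurvedCasimir.LieAlg E G),
      CurvedCasimir.curvedCasimir 𝒞 φ.toFun u X =
        (2 : ℝ) • CurvedCasimir.boxR 𝒞 T (fun y => φ.toFun y) u X
          + c₀ • φ.toFun u X) :=
  ⟨fun _ φ u X => CurvedCasimir.curvedCasimir_eq_of_isFlat
      (CurvedCasimir.homogeneousModel_isFlat p) hT hc₀ φ u X,
    fun _ _ _ _ _ _ _ _ h _ φ u X =>
      CurvedCasimir.curvedCasimir_eq_of_isFlat h.isFlat hT hc₀ φ u X⟩
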